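/- Let $k$ be a field and let $n\ge 1$ be an integer. Write $k[x]_{(x)}$ for the localization of $k[x]$ at the prime ideal $(x)$. For a $k$-algebra $R$, let $\mathcal{H}ilb^n_R$ be the contravariant functor from $k$-schemes to sets which sends $T$ to the set of closed subschemes $Z\subseteq T\times_k\operatorname{Spec}R$ such that the projection $Z\to T$ is flat and, for every point $y\in T$, the global sections of the fibre $Z_y$ have dimension $n$ as a $\kappa(y)$-vector space; morphisms act by base change. For a local noetherian $k$-algebra $R$ with maximal ideal $P$, let $\mathcal{H}ilb^nR$ be the contravariant functor from noetherian $k$-schemes to sets with $$\mathcal{H}ilb^nR(T)=\{Z\in\mathcal{H}ilb^n_R(T)\;:\;Z_{\mathrm{red}}\subseteq T\times_k\operatorname{Spec}(R/P)\}.$$ For $m\ge 0$ put $\mathcal{H}^{n,m}=\mathcal{H}ilb^n_{k[x]/(x^{n+m})}$. The surjections $k[x]_{(x)}\to k[x]/(x^{n+m+1})\to k[x]/(x^{n+m})$ allow one to regard a closed subscheme of $T\times_k\operatorname{Spec}k[x]/(x^{n+m})$ as a closed subscheme of $T\times_k\operatorname{Spec}k[x]/(x^{n+m+1})$ and of $T\times_k\operatorname{Spec}k[x]_{(x)}$.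 **Theorem.** In this way the functors $\mathcal{H}^{n,m}$, restricted to noetherian $k$-schemes, form an ascending chain of subfunctors of $\mathcal{H}ilb^n k[x]_{(x)}$, $$\mathcal{H}^{n,0}\subseteq\mathcal{H}^{n,1}\subseteq\mathcal{H}^{n,2}\subseteq\cdots\subseteq\mathcal{H}ilb^n k[x]_{(x)},$$ whose union is everything: $\mathcal{H}ilb^n k[x]_{(x)}(T)=\bigcup_{m\ge 0}\mathcal{H}^{n,m}(T)$ for every noetherian $k$-scheme $T$. Moreover, for every $m\ge 0$, the functor $\mathcal{H}^{n,m}$ is representable, and $\mathcal{H}^{n,m}$ is a closed subfunctor of $\mathcal{H}^{n,m+1}$ (that is, the inclusion $\mathcal{H}^{n,m}\to\mathcal{H}^{n,m+1}$ is relatively representable by closed immersions); both assertions hold on the category of all $k$-schemes as well as on the category of noetherian $k$-schemes. -/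

import Mathlib

open CategoryTheory CategoryTheory.Limits AlgebraicGeometry

universe u

noncomputable section

namespace PunctualHilb

/-- The dimension over `κ(y)` of the global sections of the scheme-theoretic fibre `Z_y`. -/
def fiberDim {Z T : Scheme.{u}} (f : Z ⟶ T) (y : T) : Cardinal.{u} :=
  letI : Algebra (T.residueField y) Γ(f.fiber y, ⊤) :=
    ((Scheme.ΓSpecIso (T.residueField y)).inv ≫ (f.fiberToSpecResidueField y).appTop).hom.toAlgebra
  Module.rank (T.residueField y) Γ(f.fiber y, ⊤)

/-- `f : Z ⟶ T` is flat, and the global sections of the fibre `Z_y` have dimension `n` over `κ(y)`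
for every point `y` of `T`. -/
structure IsFamily (n : ℕ) {Z T : Scheme.{u}} (f : Z ⟶ T) : Prop where
  flat : Flat f
  fiberDim_eq : ∀ y : T, fiberDim f y = n

theorem rank_of_isPushout {A B C D : CommRingCat.{u}} {a : A ⟶ B} {b : A ⟶ C} {c : B ⟶ D}
    {d : C ⟶ D} (h : IsPushout a b c d) (hA : IsField A) [Nontrivial B] :
    (letI := c.hom.toAlgebra; Module.rank B D) = (letI := b.hom.toAlgebra; Module.rank A C) := by
  let := a.hom.toAlgebra
  let := b.hom.toAlgebra
  let := c.hom.toAlgebra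
  let := d.hom.toAlgebra
  let := (a ≫ c).hom.toAlgebra
  have : IsScalarTower A B D := .of_algebraMap_eq' rfl
  have : IsScalarTower A C D := .of_algebraMap_eq' (congrArg CommRingCat.Hom.hom h.w)
  have : Module.Free A C := by
    let := hA.toField
    exact inferInstanceAs (Module.Free A C)
  have : Nontrivial A := hA.nontrivial
  have h1 : Algebra.IsPushout A B C D := CommRingCat.isPushout_iff_isPushout.mp h
  have e := (Algebra.IsPushout.equiv A B C D)
  have h2 := Module.rank_baseChange (R := B) (S := A) (M' := C)
  rw [Cardinal.lift_id] at h2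
  exact (e.toLinearEquiv.rank_eq).symm.trans h2

theorem fiberDim_of_isPullback {Z Z' T T' : Scheme.{u}} {g' : Z' ⟶ Z} {f' : Z' ⟶ T'}
    {f : Z ⟶ T} {g : T' ⟶ T} [IsAffineHom f] (h : IsPullback g' f' f g) (y : T') :
    fiberDim f' y = fiberDim f (g y) := by
  have h1 := isPullback_fiberToSpecResidueField_of_isPullback h y
  have : IsAffineHom (f.fiberToSpecResidueField (g y)) :=
    inferInstanceAs (IsAffineHom (pullback.snd f (T.fromSpecResidueField (g y))))
  have : IsAffine (f.fiber (g y)) := isAffine_of_isAffineHom (f.fiberToSpecResidueField (g y))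
  have h2 := (isPushout_appTop_of_isPullback h1.flip).of_iso
    (Scheme.ΓSpecIso _) (Scheme.ΓSpecIso _) (Iso.refl _) (Iso.refl _) (Scheme.ΓSpecIso_naturality _)
    (g' := (Scheme.ΓSpecIso (T.residueField (g y))).inv ≫
      (f.fiberToSpecResidueField (g y)).appTop)
    (inl' := (Scheme.ΓSpecIso (T'.residueField y)).inv ≫ (f'.fiberToSpecResidueField y).appTop)
    (by simp; exact Category.comp_id _) (by simp; exact Category.comp_id _) (by simp; rfl)
  exact rank_of_isPushout h2 (Field.toIsField _)

theorem IsFamily.of_isPullback {n : ℕ} {Z Z' T T' : Scheme.{u}} {g' : Z' ⟶ Z} {f' : Z' ⟶ T'}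
    {f : Z ⟶ T} {g : T' ⟶ T} [IsAffineHom f] (h : IsPullback g' f' f g) (hf : IsFamily n f) :
    IsFamily n f' where
  flat := MorphismProperty.of_isPullback h hf.flat
  fiberDim_eq y := (fiberDim_of_isPullback h y).trans (hf.fiberDim_eq (g y))


theorem isPullback_comap {X Y : Scheme.{u}} (g : X ⟶ Y) (I : Y.IdealSheafData) :
    IsPullback (Scheme.IdealSheafData.subschemeMap (I.comap g) I g (I.le_map_comap g))
      (I.comap g).subschemeι I.subschemeι g :=
  (isPullback_of_isClosedImmersion _ _ _ _ (by simp) (by simp)).flip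

theorem isPullback_map {X Y : Scheme.{u}} (i : X ⟶ Y) [IsClosedImmersion i]
    (I : X.IdealSheafData) {T : Scheme.{u}} (p : X ⟶ T) (q : Y ⟶ T) (h : i ≫ q = p) :
    IsPullback (inv (I.subschemeι ≫ i).toImage) ((I.map i).subschemeι ≫ q)
      (I.subschemeι ≫ p) (𝟙 T) := by
  refine IsPullback.of_horiz_isIso ⟨?_⟩
  rw [IsIso.inv_comp_eq, ← h, Category.comp_id]
  have := (I.subschemeι ≫ i).toImage_imageι
  have h2 := congrArg (· ≫ q) this
  simp only [Category.assoc] at h2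
  exact h2.symm

section Hilb

variable {k : Type u} [Field k] (R : Type u) [CommRing R] [Algebra k R]

/-- The structure morphism `Spec R ⟶ Spec k`. -/
abbrev specStr (k : Type u) [Field k] (R : Type u) [CommRing R] [Algebra k R] :
    Spec (CommRingCat.of R) ⟶ Spec (CommRingCat.of k) :=
  Spec.map (CommRingCat.ofHom (algebraMap k R))

/-- The structure morphism `T ⟶ Spec k` of a `k`-scheme. -/
def str {S : Scheme.{u}} (T : Over S) : T.left ⟶ S := T.hom

@[simp]
theorem left_str {S : Scheme.{u}} {U T : Over S} (f : U ⟶ T) : f.left ≫ str T = str U := Over.w f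

/-- The product `T ×_k Spec R`. -/
def prodSpec (T : Over (Spec (CommRingCat.of k))) : Scheme.{u} :=
  pullback (str T) (specStr k R)

/-- The projection `T ×_k Spec R ⟶ T`. -/
def proj (T : Over (Spec (CommRingCat.of k))) : prodSpec R T ⟶ T.left :=
  pullback.fst (str T) (specStr k R)

/-- The projection `T ×_k Spec R ⟶ Spec R`. -/
def projSpec (T : Over (Spec (CommRingCat.of k))) : prodSpec R T ⟶ Spec (CommRingCat.of R) :=
  pullback.snd (str T) (specStr k R)

theorem isPullback_prodSpec (T : Over (Spec (CommRingCat.of k))) :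
    IsPullback (proj R T) (projSpec R T) (str T) (specStr k R) :=
  IsPullback.of_hasPullback _ _

instance (T : Over (Spec (CommRingCat.of k))) : IsAffineHom (proj R T) :=
  MorphismProperty.of_isPullback (P := @IsAffineHom) (isPullback_prodSpec R T).flip inferInstance

/-- The morphism `f × id : U ×_k Spec R ⟶ T ×_k Spec R`. -/
def prodSpecMap {U T : Over (Spec (CommRingCat.of k))} (f : U ⟶ T) :
    prodSpec R U ⟶ prodSpec R T :=
  (isPullback_prodSpec R T).lift (proj R U ≫ f.left) (projSpec R U) (by
    rw [Category.assoc, left_str, (isPullback_prodSpec R U).w])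

@[simp]
theorem prodSpecMap_proj {U T : Over (Spec (CommRingCat.of k))} (f : U ⟶ T) :
    prodSpecMap R f ≫ proj R T = proj R U ≫ f.left :=
  (isPullback_prodSpec R T).lift_fst _ _ _

@[simp]
theorem prodSpecMap_projSpec {U T : Over (Spec (CommRingCat.of k))} (f : U ⟶ T) :
    prodSpecMap R f ≫ projSpec R T = projSpec R U :=
  (isPullback_prodSpec R T).lift_snd _ _ _

@[simp]
theorem prodSpecMap_id (T : Over (Spec (CommRingCat.of k))) :
    prodSpecMap R (𝟙 T) = 𝟙 _ :=
  (isPullback_prodSpec R T).hom_ext (by simp) (by simp)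

@[simp]
theorem prodSpecMap_comp {V U T : Over (Spec (CommRingCat.of k))} (g : V ⟶ U) (f : U ⟶ T) :
    prodSpecMap R (g ≫ f) = prodSpecMap R g ≫ prodSpecMap R f := by
  refine (isPullback_prodSpec R T).hom_ext ?_ (by simp)
  rw [Category.assoc, prodSpecMap_proj, prodSpecMap_proj, ← Category.assoc, prodSpecMap_proj,
    Over.comp_left, Category.assoc]

theorem isPullback_prodSpecMap {U T : Over (Spec (CommRingCat.of k))} (f : U ⟶ T) :
    IsPullback (prodSpecMap R f) (proj R U) (proj R T) f.left := by
  refine IsPullback.of_right (h₁₂ := projSpec R T) (h₂₂ := str T) (v₁₃ := specStr k R) ?_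
    (prodSpecMap_proj R f) (isPullback_prodSpec R T).flip
  rw [prodSpecMap_projSpec, left_str]
  exact (isPullback_prodSpec R U).flip

section

variable {R} {S : Type u} [CommRing S] [Algebra k S] (φ : R →ₐ[k] S)

/-- The morphism `Spec S ⟶ Spec R` of a `k`-algebra map `φ : R → S`. -/
abbrev specMap : Spec (CommRingCat.of S) ⟶ Spec (CommRingCat.of R) :=
  Spec.map (CommRingCat.ofHom φ.toRingHom)

theorem specMap_str : specMap φ ≫ specStr k R = specStr k S := by
  have h : φ.toRingHom.comp (algebraMap k R) = algebraMap k S := φ.comp_algebraMap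
  rw [← Spec.map_comp, ← CommRingCat.ofHom_comp, h]

/-- The morphism `id × Spec φ : T ×_k Spec S ⟶ T ×_k Spec R` of a `k`-algebra map `φ : R → S`. -/
def prodSpecChange (T : Over (Spec (CommRingCat.of k))) : prodSpec S T ⟶ prodSpec R T :=
  (isPullback_prodSpec R T).lift (proj S T) (projSpec S T ≫ specMap φ) (by
    rw [Category.assoc, specMap_str, (isPullback_prodSpec S T).w])

@[simp]
theorem prodSpecChange_proj (T : Over (Spec (CommRingCat.of k))) :
    prodSpecChange φ T ≫ proj R T = proj S T :=
  (isPullback_prodSpec R T).lift_fst _ _ _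

@[simp]
theorem prodSpecChange_projSpec (T : Over (Spec (CommRingCat.of k))) :
    prodSpecChange φ T ≫ projSpec R T = projSpec S T ≫ specMap φ :=
  (isPullback_prodSpec R T).lift_snd _ _ _

theorem isPullback_prodSpecChange (T : Over (Spec (CommRingCat.of k))) :
    IsPullback (prodSpecChange φ T) (projSpec S T) (projSpec R T) (specMap φ) := by
  refine IsPullback.of_right (h₁₂ := proj R T) (h₂₂ := specStr k R) (v₁₃ := str T) ?_
    (prodSpecChange_projSpec φ T) (isPullback_prodSpec R T)
  rw [prodSpecChange_proj, specMap_str]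
  exact isPullback_prodSpec S T

theorem prodSpecChange_naturality {U T : Over (Spec (CommRingCat.of k))} (f : U ⟶ T) :
    prodSpecMap S f ≫ prodSpecChange φ T = prodSpecChange φ U ≫ prodSpecMap R f := by
  refine (isPullback_prodSpec R T).hom_ext ?_ ?_
  · rw [Category.assoc, prodSpecChange_proj, prodSpecMap_proj, Category.assoc, prodSpecMap_proj,
      ← Category.assoc, prodSpecChange_proj]
  · rw [Category.assoc, prodSpecChange_projSpec, ← Category.assoc, prodSpecMap_projSpec,
      Category.assoc, prodSpecMap_projSpec, prodSpecChange_projSpec]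

theorem isPullback_prodSpecMap_prodSpecChange {U T : Over (Spec (CommRingCat.of k))}
    (f : U ⟶ T) : IsPullback (prodSpecMap S f) (prodSpecChange φ U) (prodSpecChange φ T)
      (prodSpecMap R f) := by
  refine IsPullback.of_bot (v₂₁ := proj R U) (v₂₂ := proj R T) (h₃₁ := f.left) ?_
    (prodSpecChange_naturality φ f) (isPullback_prodSpecMap R f)
  rw [prodSpecChange_proj, prodSpecChange_proj]
  exact isPullback_prodSpecMap S f

theorem isClosedImmersion_prodSpecChange (hφ : Function.Surjective φ)
    (T : Over (Spec (CommRingCat.of k))) : IsClosedImmersion (prodSpecChange φ T) :=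
  have : IsClosedImmersion (specMap φ) := IsClosedImmersion.spec_of_surjective _ hφ
  MorphismProperty.of_isPullback (isPullback_prodSpecChange φ T).flip this

/-- Pushing a closed subscheme forward along a closed immersion commutes with base change. -/
theorem comap_map_of_isPullback {X Y X' Y' : Scheme.{u}} {g' : X' ⟶ X} {i' : X' ⟶ Y'}
    {i : X ⟶ Y} {g : Y' ⟶ Y} [IsClosedImmersion i] (h : IsPullback g' i' i g)
    (I : X.IdealSheafData) : (I.comap g').map i' = (I.map i).comap g := by
  have h1 := (isPullback_comap g' I).paste_vert h
  have h2 := Scheme.IdealSheafData.ker_fst_of_isClosedImmersion (I.subschemeι ≫ i) g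
  change _ = (I.subschemeι ≫ i).ker.comap g
  rw [← h2, ← Scheme.Hom.ker_comp_of_isIso h1.flip.isoPullback.hom, h1.flip.isoPullback_hom_fst]
  rfl

/-- The points of `T ×_k Spec (R/P)` are those lying over the zero locus of `P` in `Spec R`. -/
theorem ker_le_radical_iff (hφ : Function.Surjective φ) (T : Over (Spec (CommRingCat.of k)))
    (I : (prodSpec R T).IdealSheafData) :
    (prodSpecChange φ T).ker ≤ I.radical ↔
      ∀ x ∈ I.support, RingHom.ker φ ≤ (projSpec R T x).asIdeal := by
  have := isClosedImmersion_prodSpecChange φ hφ T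
  rw [← Scheme.IdealSheafData.vanishingIdeal_support,
    ← Scheme.IdealSheafData.le_support_iff_le_vanishingIdeal, ← SetLike.coe_subset_coe,
    Scheme.Hom.support_ker, (prodSpecChange φ T).isClosedEmbedding.isClosed_range.closure_eq]
  have h := Scheme.image_preimage_eq_of_isPullback (isPullback_prodSpecChange φ T).flip Set.univ
  rw [Set.preimage_univ, Set.image_univ, Set.image_univ] at h
  have h2 : Set.range (specMap φ).base = PrimeSpectrum.zeroLocus (RingHom.ker φ : Set R) :=
    range_comap_of_surjective _ φ.toRingHom hφ
  rw [h2] at h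
  exact forall_congr' fun x ↦ imp_congr_right fun _ ↦ (Set.ext_iff.mp h x)

end

/-- The Hilbert functor of `n` points on `Spec R`. A closed subscheme `Z` of `T ×_k Spec R` is given
by its quasi-coherent ideal sheaf, and pulling back ideal sheaves is the base change of `Z`. -/
def hilb (k : Type u) [Field k] (R : Type u) [CommRing R] [Algebra k R] (n : ℕ) :
    (Over (Spec (CommRingCat.of k)))ᵒᵖ ⥤ Type u where
  obj T := {Z : (prodSpec R T.unop).IdealSheafData //
    IsFamily n (Z.subschemeι ≫ proj R T.unop)}
  map f := ↾fun Z ↦ ⟨Z.1.comap (prodSpecMap R f.unop),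
    Z.2.of_isPullback ((isPullback_comap _ _).paste_vert (isPullback_prodSpecMap R f.unop))⟩
  map_id T := by
    refine ConcreteCategory.hom_ext _ _ fun Z ↦ Subtype.ext ?_
    simp
  map_comp f g := by
    refine ConcreteCategory.hom_ext _ _ fun Z ↦ Subtype.ext ?_
    simp

/-- For a surjection `φ : R → S`, the inclusion of Hilbert functors which regards a closed subscheme
of `T ×_k Spec S` as a closed subscheme of `T ×_k Spec R`. -/
def hilbPush {S : Type u} [CommRing S] [Algebra k S] (φ : R →ₐ[k] S)
    (hφ : Function.Surjective φ) (n : ℕ) : hilb k S n ⟶ hilb k R n where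
  app T := ↾fun Z ↦ ⟨Z.1.map (prodSpecChange φ T.unop), by
    have := isClosedImmersion_prodSpecChange φ hφ T.unop
    exact Z.2.of_isPullback (isPullback_map _ Z.1 _ _ (prodSpecChange_proj φ T.unop))⟩
  naturality T U f := by
    refine ConcreteCategory.hom_ext _ _ fun Z ↦ Subtype.ext ?_
    have := isClosedImmersion_prodSpecChange φ hφ T.unop
    have := isClosedImmersion_prodSpecChange φ hφ U.unop
    exact (comap_map_of_isPullback (isPullback_prodSpecMap_prodSpecChange φ f.unop) Z.1)

/-- For a local `k`-algebra `R` with maximal ideal `P`, those `Z` in the Hilbert functor of `n` points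
on `Spec R` for which `Z_red` is contained in `T ×_k Spec (R/P)`. Here `Z_red` is the closed
subscheme whose ideal sheaf is the radical of that of `Z`, and containment of closed subschemes is
reverse containment of ideal sheaves. -/
def hilbSupp (k : Type u) [Field k] (R : Type u) [CommRing R] [Algebra k R] [IsLocalRing R]
    (n : ℕ) : Subfunctor (hilb k R n) where
  obj T := {Z | (prodSpecChange (Ideal.Quotient.mkₐ k (IsLocalRing.maximalIdeal R)) T.unop).ker ≤
    Z.1.radical}
  map f := by
    intro Z hZ
    have hs : Function.Surjective (Ideal.Quotient.mkₐ k (IsLocalRing.maximalIdeal R)) :=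
      Ideal.Quotient.mkₐ_surjective _ _
    have hZ' := (ker_le_radical_iff _ hs _ _).mp hZ
    refine (ker_le_radical_iff _ hs _ _).mpr fun x hx ↦ ?_
    have hx' : prodSpecMap R f.unop x ∈ Z.1.support := by
      have hx2 := hx
      change x ∈ (Z.1.comap (prodSpecMap R f.unop)).support at hx2
      rwa [Scheme.IdealSheafData.support_comap] at hx2
    have h := hZ' _ hx'
    rwa [← Scheme.Hom.comp_apply, prodSpecMap_projSpec] at h

end Hilb

section Line

open Polynomial

variable (k : Type u) [Field k]

/-- The prime ideal `(x)` of `k[x]`. -/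
abbrev originIdeal : Ideal k[X] := Ideal.span {X}

instance : (originIdeal k).IsPrime :=
  (Ideal.span_singleton_prime X_ne_zero).mpr prime_X

/-- The local ring `k[x]_(x)`. -/
abbrev LocalLine : Type u := Localization.AtPrime (originIdeal k)

/-- The ring `k[x]/(x^N)`. -/
abbrev TruncLine (N : ℕ) : Type u := k[X] ⧸ Ideal.span {(X : k[X]) ^ N}

theorem isUnit_mk_of_notMem (N : ℕ) (y : (originIdeal k).primeCompl) :
    IsUnit (Ideal.Quotient.mkₐ k (Ideal.span {(X : k[X]) ^ N}) y) := by
  have h : IsCoprime (X : k[X]) y :=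
    (irreducible_X.coprime_iff_not_dvd).mpr fun h ↦ y.2 (Ideal.mem_span_singleton.mpr h)
  obtain ⟨a, b, hab⟩ := h.pow_left (m := N)
  refine IsUnit.of_mul_eq_one (Ideal.Quotient.mkₐ k _ b) ?_
  rw [← map_mul, mul_comm, ← map_one (Ideal.Quotient.mkₐ k _)]
  refine Ideal.Quotient.eq.mpr (Ideal.mem_span_singleton.mpr ⟨-a, ?_⟩)
  linear_combination hab

/-- The canonical surjection `k[x]_(x) → k[x]/(x^N)`. -/
def localToTrunc (N : ℕ) : LocalLine k →ₐ[k] TruncLine k N :=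
  IsLocalization.liftAlgHom (M := (originIdeal k).primeCompl) (isUnit_mk_of_notMem k N)

theorem localToTrunc_algebraMap (N : ℕ) (f : k[X]) :
    localToTrunc k N (algebraMap k[X] (LocalLine k) f) = Ideal.Quotient.mk _ f :=
  IsLocalization.lift_eq _ _

theorem localToTrunc_surjective (N : ℕ) : Function.Surjective (localToTrunc k N) := fun y ↦ by
  obtain ⟨f, rfl⟩ := Ideal.Quotient.mk_surjective y
  exact ⟨_, localToTrunc_algebraMap k N f⟩

/-- The canonical surjection `k[x]/(x^(N+1)) → k[x]/(x^N)`. -/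
def truncToTrunc (N : ℕ) : TruncLine k (N + 1) →ₐ[k] TruncLine k N :=
  Ideal.Quotient.factorₐ k (I := Ideal.span {(X : k[X]) ^ (N + 1)})
    (J := Ideal.span {(X : k[X]) ^ N})
    (Ideal.span_singleton_le_span_singleton.mpr (pow_dvd_pow X N.le_succ))

theorem truncToTrunc_surjective (N : ℕ) : Function.Surjective (truncToTrunc k N) :=
  Ideal.Quotient.factor_surjective
    (Ideal.span_singleton_le_span_singleton.mpr (pow_dvd_pow X N.le_succ))

/-- The category of noetherian `k`-schemes, as a full subcategory of all `k`-schemes. -/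
abbrev isNoeth : ObjectProperty (Over (Spec (CommRingCat.of k))) := fun T ↦ IsNoetherian T.left

/-- The restriction to noetherian `k`-schemes of a contravariant functor on `k`-schemes. -/
abbrev restrictNoeth (F : (Over (Spec (CommRingCat.of k)))ᵒᵖ ⥤ Type u) :
    (isNoeth k).FullSubcategoryᵒᵖ ⥤ Type u :=
  (isNoeth k).ι.op ⋙ F

/-- The functor `Hilb^n k[x]_(x)` on noetherian `k`-schemes. -/
abbrev hilbLocal (n : ℕ) : (isNoeth k).FullSubcategoryᵒᵖ ⥤ Type u :=
  restrictNoeth k (hilbSupp k (LocalLine k) n).toFunctor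

/-- The functor `H^{n,m}` on all `k`-schemes: the Hilbert functor of `n` points on
`Spec k[x]/(x^(n+m))`. -/
abbrev hilbTrunc (n m : ℕ) : (Over (Spec (CommRingCat.of k)))ᵒᵖ ⥤ Type u :=
  hilb k (TruncLine k (n + m)) n

/-- The functor `H^{n,m}` on noetherian `k`-schemes. -/
abbrev hilbTruncNoeth (n m : ℕ) : (isNoeth k).FullSubcategoryᵒᵖ ⥤ Type u :=
  restrictNoeth k (hilbTrunc k n m)

/-- The inclusion `H^{n,m} ⟶ H^{n,m+1}`, which regards a closed subscheme of
`T ×_k Spec k[x]/(x^(n+m))` as a closed subscheme of `T ×_k Spec k[x]/(x^(n+m+1))`. -/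
def truncIncl (n m : ℕ) : hilbTrunc k n m ⟶ hilbTrunc k n (m + 1) :=
  hilbPush _ (truncToTrunc k (n + m)) (truncToTrunc_surjective k (n + m)) n

/-- The inclusion `H^{n,m} ⟶ H^{n,m+1}` on noetherian `k`-schemes. -/
def truncInclNoeth (n m : ℕ) : hilbTruncNoeth k n m ⟶ hilbTruncNoeth k n (m + 1) :=
  Functor.whiskerLeft (isNoeth k).ι.op (truncIncl k n m)

theorem range_hilbPush_le (n N : ℕ) :
    Subfunctor.range (hilbPush _ (localToTrunc k N) (localToTrunc_surjective k N) n) ≤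
      hilbSupp k (LocalLine k) n := by
  rintro T _ ⟨Z, rfl⟩
  refine (ker_le_radical_iff _ (Ideal.Quotient.mkₐ_surjective _ _) _ _).mpr fun x hx ↦ ?_
  have := isClosedImmersion_prodSpecChange _ (localToTrunc_surjective k N) T.unop
  have hx2 := hx
  change x ∈ (Z.1.map (prodSpecChange (localToTrunc k N) T.unop)).support at hx2
  rw [Scheme.IdealSheafData.support_map] at hx2
  have hx3 : x ∈ Set.range (prodSpecChange (localToTrunc k N) T.unop) :=
    closure_minimal (Set.image_subset_range _ _)
      (prodSpecChange (localToTrunc k N) T.unop).isClosedEmbedding.isClosed_range hx2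
  obtain ⟨z, rfl⟩ := hx3
  rw [← Scheme.Hom.comp_apply, prodSpecChange_projSpec, Scheme.Hom.comp_apply]
  generalize projSpec (TruncLine k N) T.unop z = q
  change _ ≤ q.asIdeal.comap (localToTrunc k N).toRingHom
  have hk : RingHom.ker (Ideal.Quotient.mkₐ k (IsLocalRing.maximalIdeal (LocalLine k))) =
      IsLocalRing.maximalIdeal (LocalLine k) := Ideal.mk_ker
  rw [hk, ← Localization.AtPrime.map_eq_maximalIdeal, Ideal.map_span,
    Set.image_singleton, Ideal.span_singleton_le_iff_mem, Ideal.mem_comap]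
  refine q.2.mem_of_pow_mem N ?_
  rw [← map_pow, ← map_pow]
  have h0 : localToTrunc k N (algebraMap k[X] (LocalLine k) (X ^ N)) = 0 := by
    rw [localToTrunc_algebraMap]
    exact Ideal.Quotient.eq_zero_iff_mem.mpr (Ideal.mem_span_singleton_self _)
  have h1 : (localToTrunc k N).toRingHom (algebraMap k[X] (LocalLine k) (X ^ N)) = 0 := h0
  rw [h1]
  exact q.asIdeal.zero_mem

/-- The inclusion `H^{n,m} ⟶ Hilb^n k[x]_(x)` on noetherian `k`-schemes, which regards a closed
subscheme of `T ×_k Spec k[x]/(x^(n+m))` as a closed subscheme of `T ×_k Spec k[x]_(x)`. -/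
def truncToLocal (n m : ℕ) : hilbTruncNoeth k n m ⟶ hilbLocal k n :=
  Functor.whiskerLeft (isNoeth k).ι.op
    (Subfunctor.lift _ (range_hilbPush_le k n (n + m)))

/-- A morphism of `k`-schemes which is a closed immersion. -/
def closedImm : MorphismProperty (Over (Spec (CommRingCat.of k))) :=
  MorphismProperty.over @IsClosedImmersion

/-- A morphism of noetherian `k`-schemes which is a closed immersion. -/
def closedImmNoeth : MorphismProperty (isNoeth k).FullSubcategory :=
  (closedImm k).inverseImage (isNoeth k).ι

end Line

end PunctualHilb

end

/-!
Over an affine base `T = Spec A`, a closed subscheme `Z` of `T ×_k Spec k[x]/(x^N)` is a quotient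
`C` of `A[x]/(x^N)`. If `C` is flat over `A` with all fibres of dimension `n`, then `x ^ n`
vanishes in every fibre, because `x` is nilpotent there. Nakayama's lemma shows that the powers of
`x` below `n` generate `C`, and comparing ranks shows that they form a basis. Hence `C = A[x]/(q)` for
a unique monic polynomial `q` of degree `n`, and `q` divides `x ^ N`; conversely every such `q`
gives a family (`exists_eq_cut`, `cut_injective`, `isFamily_cut`).

So for `N = n + m` the families over `A` are the factorizations of `x ^ (n + m)` into monic
polynomials of degrees `n` and `m` over `A`. These are parametrised by Mathlib's
`Polynomial.UniversalFactorizationRing`, a finite `k`-algebra. Closed subschemes are determined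
Zariski-locally and morphisms glue, so the spectrum of this ring represents the functor on all
schemes (`hilbTruncRepresentableBy`); being noetherian, it also represents the restriction to
noetherian schemes.

The inclusion of `H^{n,m}` in `H^{n,m+1}` is injective, hence is given by a monomorphism of
representing schemes. These are finite over `k`, so the monomorphism is finite, and finite
monomorphisms are closed immersions (`isClosedImmersion_of_mono`). This gives the closed
subfunctors.

For the union, let `Z` be a closed subscheme of `T ×_k Spec k[x]_(x)` supported at the origin,
with `T` noetherian. Then `Z` is quasi-compact and `x` vanishes at all its points, so `x` is
nilpotent on `Z` and `Z` lies in `T ×_k Spec k[x]/(x^N)` for large `N`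
(`exists_map_prodSpecChange_eq`).
-/

namespace PunctualHilb

open Polynomial TensorProduct

/-! ### Algebras generated by one nilpotent element -/

/-- Fibre dimensions of a module do not change under field extension. -/
theorem finrank_tensorProduct_trans (A F K M : Type*) [CommRing A] [Field F] [Field K]
    [Algebra A F] [Algebra A K] [Algebra F K] [IsScalarTower A F K] [AddCommGroup M] [Module A M] :
    Module.finrank K (K ⊗[A] M) = Module.finrank F (F ⊗[A] M) := by
  rw [← (AlgebraTensorModule.cancelBaseChange A F K K M).finrank_eq, Module.finrank_baseChange]

/-- By Cayley–Hamilton, since the characteristic polynomial of a nilpotent endomorphism of a space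
of dimension `d` is `X ^ d`. -/
theorem pow_finrank_eq_zero_of_isNilpotent {F D : Type*} [Field F] [CommRing D] [Algebra F D]
    [Module.Finite F D] {c : D} (hc : IsNilpotent c) : c ^ Module.finrank F D = 0 := by
  have h := (hc.map (Algebra.lmul F D)).charpoly_eq_X_pow_finrank
  have h2 := (Algebra.lmul F D c).aeval_self_charpoly
  rw [h, map_pow, aeval_X, ← map_pow] at h2
  simpa using congr($h2 1)

/-- Nakayama's lemma for a finite module, checked at all maximal ideals: a submodule which spans
modulo every maximal ideal is everything. -/
theorem eq_top_of_forall_isMaximal_sup {A M : Type*} [CommRing A]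
    [AddCommGroup M] [Module A M] [Module.Finite A M] (S : Submodule A M)
    (h : ∀ m : Ideal A, m.IsMaximal → S ⊔ m • ⊤ = ⊤) : S = ⊤ := by
  by_contra hS
  have hne : Module.annihilator A (M ⧸ S) ≠ ⊤ := by
    rw [Ne, Module.annihilator_eq_top_iff]
    exact fun hh ↦ hS ((Submodule.Quotient.subsingleton_iff).mp hh)
  obtain ⟨m, hm, hle⟩ := Ideal.exists_le_maximal _ hne
  have h1 : (⊤ : Submodule A (M ⧸ S)) ≤ m • ⊤ := by
    have h2 := congr(Submodule.map S.mkQ $(h m hm))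
    rw [Submodule.map_sup, Submodule.mkQ_map_self, bot_sup_eq, Submodule.map_smul'',
      Submodule.map_top, Submodule.range_mkQ] at h2
    exact h2.ge
  obtain ⟨r, hr, hr0⟩ := Submodule.exists_sub_one_mem_and_smul_eq_zero_of_fg_of_le_smul m _
    Module.Finite.fg_top h1
  have h3 : r ∈ m := hle (Module.mem_annihilator.mpr fun x ↦ hr0 x trivial)
  exact hm.ne_top ((Ideal.eq_top_iff_one m).mpr (by simpa using m.sub_mem h3 hr))

section

variable {A C : Type u} [CommRing A] [CommRing C] [Algebra A C] {n : ℕ} {c : C}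

theorem pow_mem_smul_top_of_finrank (m : Ideal A) [m.IsMaximal] [Module.Finite A C]
    (hc : IsNilpotent c) (h : Module.finrank (A ⧸ m) ((A ⧸ m) ⊗[A] C) = n) :
    c ^ n ∈ m • (⊤ : Submodule A C) := by
  let := Ideal.Quotient.field m
  have h1 : IsNilpotent ((1 : A ⧸ m) ⊗ₜ[A] c) :=
    hc.map (Algebra.TensorProduct.includeRight : C →ₐ[A] (A ⧸ m) ⊗[A] C)
  have h2 := pow_finrank_eq_zero_of_isNilpotent (F := A ⧸ m) h1
  rw [h, Algebra.TensorProduct.tmul_pow, one_pow] at h2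
  have h3 := congr(TensorProduct.quotTensorEquivQuotSMul C m $h2)
  rw [map_zero] at h3
  have h4 : TensorProduct.quotTensorEquivQuotSMul C m ((1 : A ⧸ m) ⊗ₜ[A] (c ^ n)) =
    Submodule.Quotient.mk (c ^ n) := by
    exact TensorProduct.quotTensorEquivQuotSMul_mk_one_tmul m (c ^ n)
  rw [h4] at h3
  exact (Submodule.Quotient.mk_eq_zero _).mp h3

theorem finite_of_aeval_surjective (hs : Function.Surjective (aeval c : A[X] →ₐ[A] C))
    (hc : IsNilpotent c) : Module.Finite A C := by
  obtain ⟨N, hN⟩ := hc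
  have := (monic_X_pow (R := A) N).finite_adjoinRoot
  refine Module.Finite.of_surjective
    (AdjoinRoot.liftAlgHom (X ^ N : A[X]) (Algebra.ofId A C) c (by simp [hN])).toLinearMap ?_
  intro y
  obtain ⟨p, rfl⟩ := hs y
  exact ⟨AdjoinRoot.mk _ p, by simp; rfl⟩

/-- A nilpotent generator `c` satisfies `c ^ n = 0` in each fibre of dimension `n`, so that the
powers of `c` below `n` span every fibre, hence span `C` by Nakayama's lemma. -/
theorem span_pow_eq_top (hs : Function.Surjective (aeval c : A[X] →ₐ[A] C))
    (hc : IsNilpotent c)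
    (h : ∀ m : Ideal A, m.IsMaximal → Module.finrank (A ⧸ m) ((A ⧸ m) ⊗[A] C) = n) :
    Submodule.span A (Set.range fun i : Fin n ↦ c ^ (i : ℕ)) = ⊤ := by
  have := finite_of_aeval_surjective hs hc
  refine eq_top_of_forall_isMaximal_sup _ fun m hm ↦ ?_
  have hn := pow_mem_smul_top_of_finrank m hc (h m hm)
  refine eq_top_iff.mpr fun y _ ↦ ?_
  obtain ⟨p, rfl⟩ := hs y
  rw [aeval_eq_sum_range]
  refine Submodule.sum_mem _ fun j _ ↦ Submodule.smul_mem _ _ ?_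
  rcases lt_or_ge j n with hj | hj
  · exact Submodule.mem_sup_left (Submodule.subset_span ⟨⟨j, hj⟩, rfl⟩)
  · refine Submodule.mem_sup_right ?_
    have h1 := Submodule.mem_map_of_mem (f := LinearMap.mulLeft A (c ^ (j - n))) hn
    rw [LinearMap.mulLeft_apply, ← pow_add, Nat.sub_add_cancel hj, Submodule.map_smul''] at h1
    exact Submodule.smul_mono le_rfl le_top h1

/-- The powers of `c` below `n` are a basis: the surjection `A ^ n → C` which they define goes to a
finite flat module whose rank is `n` at every maximal ideal. -/
theorem bijective_linearCombination_pow [Module.Flat A C]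
    (hs : Function.Surjective (aeval c : A[X] →ₐ[A] C)) (hc : IsNilpotent c)
    (h : ∀ m : Ideal A, m.IsMaximal → Module.finrank (A ⧸ m) ((A ⧸ m) ⊗[A] C) = n) :
    Function.Bijective (Fintype.linearCombination A (fun i : Fin n ↦ c ^ (i : ℕ))) := by
  have := finite_of_aeval_surjective hs hc
  refine Module.bijective_of_surjective_of_rankAtStalk_eq ?_ fun m hm ↦ ?_
  · rw [← LinearMap.range_eq_top, Fintype.range_linearCombination, span_pow_eq_top hs hc h]
  · have : Nontrivial (A ⧸ m) := Ideal.Quotient.nontrivial_iff.mpr hm.ne_top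
    have : Nontrivial A := (Ideal.Quotient.mk m).domain_nontrivial
    let := Ideal.Quotient.field m
    rw [Module.rankAtStalk_eq_finrank_of_free, Module.rankAtStalk_eq]
    have h1 := finrank_tensorProduct_trans A (A ⧸ m) m.ResidueField C
    simp [h1, h m hm]

/-- A flat algebra of fibre rank `n` generated by one nilpotent element is `A[X] ⧸ (q)` for a monic
polynomial `q` of degree `n`. -/
theorem exists_ker_aeval_eq_span [Module.Flat A C]
    (hs : Function.Surjective (aeval c : A[X] →ₐ[A] C)) (hc : IsNilpotent c)
    (h : ∀ m : Ideal A, m.IsMaximal → Module.finrank (A ⧸ m) ((A ⧸ m) ⊗[A] C) = n) :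
    ∃ q : MonicDegreeEq A n, RingHom.ker (aeval c : A[X] →ₐ[A] C) = Ideal.span {q.1} := by
  have hb := bijective_linearCombination_pow hs hc h
  obtain ⟨a, ha⟩ := hb.2 (-c ^ n)
  -- `q = X ^ n + ∑ i, a i * X ^ i`, where `-c ^ n = ∑ i, a i * c ^ i`
  let q := MvPolynomial.mapEquivMonic A A n (MvPolynomial.aeval a)
  have hq : aeval c q.1 = 0 := by
    rw [Fintype.linearCombination_apply] at ha
    simp [q, MvPolynomial.mapEquivMonic, freeMonic, Polynomial.map_sum, ← Algebra.smul_def, ha]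
  refine ⟨q, le_antisymm (fun g hg ↦ ?_) ?_⟩
  · have h1 := modByMonic_add_div g q.1
    -- the remainder of `g` modulo `q` is a linear relation between the powers of `c` below `n`
    have h2 : aeval c (g %ₘ q.1) = 0 := by
      have h3 := congr(aeval c $h1)
      rwa [map_add, map_mul, hq, zero_mul, add_zero, show aeval c g = 0 from hg] at h3
    nontriviality A
    have hd : (g %ₘ q.1).degree < n := (degree_modByMonic_lt g q.monic).trans_eq q.degree
    have h4 : (fun i : Fin n ↦ (g %ₘ q.1).coeff i) = 0 := by
      refine hb.1 ?_
      rw [map_zero, ← h2, aeval_def, eval₂_eq_sum, ← sum_fin _ (by simp) hd,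
        Fintype.linearCombination_apply]
      simp [Algebra.smul_def]
    have h5 : g %ₘ q.1 = 0 := by
      ext i
      rcases lt_or_ge i n with hi | hi
      · exact congr_fun h4 ⟨i, hi⟩
      · exact coeff_eq_zero_of_degree_lt (hd.trans_le (by exact_mod_cast hi))
    rw [h5, zero_add] at h1
    exact Ideal.mem_span_singleton.mpr ⟨_, h1.symm⟩
  · rw [Ideal.span_singleton_le_iff_mem]
    exact hq

/-- The isomorphism `A[X] ⧸ (q) ≃ C` for an algebra `C` generated by an element whose ideal of
polynomial relations is `(q)`. -/
noncomputable def quotientSpanEquivOfKer {q : A[X]}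
    (hs : Function.Surjective (aeval c : A[X] →ₐ[A] C))
    (hk : RingHom.ker (aeval c : A[X] →ₐ[A] C) = Ideal.span {q}) :
    (A[X] ⧸ Ideal.span {q}) ≃ₐ[A] C :=
  (Ideal.quotientEquivAlgOfEq A hk.symm).trans (Ideal.quotientKerAlgEquivOfSurjective hs)

theorem free_of_ker_aeval_eq_span (q : MonicDegreeEq A n)
    (hs : Function.Surjective (aeval c : A[X] →ₐ[A] C))
    (hk : RingHom.ker (aeval c : A[X] →ₐ[A] C) = Ideal.span {q.1}) : Module.Free A C :=
  have := q.monic.free_quotient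
  .of_equiv (quotientSpanEquivOfKer hs hk).toLinearEquiv

theorem rank_tensorProduct_of_ker_aeval_eq_span (q : MonicDegreeEq A n)
    (hs : Function.Surjective (aeval c : A[X] →ₐ[A] C))
    (hk : RingHom.ker (aeval c : A[X] →ₐ[A] C) = Ideal.span {q.1}) (K : Type u) [Field K]
    [Algebra A K] : Module.rank K (K ⊗[A] C) = n := by
  have : Nontrivial A := (algebraMap A K).domain_nontrivial
  have := free_of_ker_aeval_eq_span q hs hk
  have e := (quotientSpanEquivOfKer hs hk).toLinearEquiv
  have := q.monic.finite_quotient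
  have := q.monic.free_quotient
  rw [Module.rank_baseChange, Cardinal.lift_id, ← e.rank_eq, ← Module.finrank_eq_rank]
  congr 1
  exact (AdjoinRoot.powerBasis' q.monic).finrank.trans q.natDegree

end

section

variable {A : Type*} [CommRing A]

theorem MonicDegreeEq.ext_of_span_eq {n : ℕ} {p q : MonicDegreeEq A n}
    (h : Ideal.span {p.1} = Ideal.span {q.1}) : p = q := by
  refine Subtype.ext ?_
  have h1 : p.1 ∣ q.1 := Ideal.mem_span_singleton.mp (h ▸ Ideal.mem_span_singleton_self _)
  nontriviality A
  exact (eq_of_monic_of_dvd_of_natDegree_le p.monic q.monic h1 (by simp)).symm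

theorem MonicDegreeEq.exists_mul_eq_X_pow {n m : ℕ} {q : MonicDegreeEq A n}
    (h : q.1 ∣ X ^ (n + m)) : ∃ r : MonicDegreeEq A m, q.1 * r.1 = X ^ (n + m) := by
  rcases subsingleton_or_nontrivial A with hA | hA
  -- over the zero ring every polynomial is monic of degree `m` in the sense of `MonicDegreeEq`
  · exact ⟨⟨0, Subsingleton.elim _ _, fun _ _ ↦ rfl⟩, Subsingleton.elim _ _⟩
  obtain ⟨r, hr⟩ := h
  have hm : r.Monic := q.monic.of_mul_monic_left (hr ▸ monic_X_pow _)
  refine ⟨.mk r hm ?_, hr.symm⟩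
  have h1 := congr(natDegree $hr)
  rw [q.monic.natDegree_mul hm, natDegree_X_pow, q.natDegree] at h1
  omega

end

/-! ### Fibres and ideal sheaves over affine schemes -/

theorem comap_ofIdealTop {X Y : Scheme.{u}} [IsAffine X] [IsAffine Y] (f : X ⟶ Y)
    (I : Ideal Γ(Y, ⊤)) : (Scheme.IdealSheafData.ofIdealTop I).comap f =
      .ofIdealTop (I.map f.appTop.hom) := by
  -- both sides are characterised by the ideal sheaves above them
  have key (Z : Scheme.{u}) [IsAffine Z] (I : Ideal Γ(Z, ⊤)) (J : Z.IdealSheafData) :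
      .ofIdealTop I ≤ J ↔ I ≤ J.ideal ⟨⊤, isAffineOpen_top Z⟩ := by
    refine ⟨fun h ↦ ?_, fun h ↦ Scheme.IdealSheafData.le_of_isAffine ?_⟩
    · simpa using h ⟨⊤, isAffineOpen_top Z⟩
    · simpa using h
  refine eq_of_forall_ge_iff fun J ↦ ?_
  rw [← Scheme.IdealSheafData.le_map_iff_comap_le, key, key, Ideal.map_le_iff_le_comap,
    Scheme.IdealSheafData.ideal_map_of_isAffineHom]
  rfl

theorem rank_of_isPushout_tensorProduct {A K C D : CommRingCat.{u}} {a : A ⟶ K} {b : A ⟶ C}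
    {c : K ⟶ D} {d : C ⟶ D} (h : IsPushout a b c d) :
    (letI := c.hom.toAlgebra; Module.rank K D) =
      (letI := a.hom.toAlgebra; letI := b.hom.toAlgebra; Module.rank K (K ⊗[A] C)) := by
  let := a.hom.toAlgebra
  let := b.hom.toAlgebra
  let := c.hom.toAlgebra
  let := d.hom.toAlgebra
  let := (a ≫ c).hom.toAlgebra
  have : IsScalarTower A K D := .of_algebraMap_eq' rfl
  have : IsScalarTower A C D := .of_algebraMap_eq' (congrArg CommRingCat.Hom.hom h.w)
  have h1 : Algebra.IsPushout A K C D := CommRingCat.isPushout_iff_isPushout.mp h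
  exact (Algebra.IsPushout.equiv A K C D).toLinearEquiv.rank_eq.symm

/-- The value at a point `y` of a global function. -/
noncomputable abbrev evalAt (T : Scheme.{u}) (y : T) : Γ(T, ⊤) ⟶ T.residueField y :=
  (T.fromSpecResidueField y).appTop ≫ (Scheme.ΓSpecIso (T.residueField y)).hom

/-- Over an affine base, the dimension of the global sections of a fibre is the dimension of the
fibre of the module of global sections. -/
theorem fiberDim_of_isAffine {Z T : Scheme.{u}} [IsAffine Z] [IsAffine T] (f : Z ⟶ T) (y : T) :
    fiberDim f y = (letI := (evalAt T y).hom.toAlgebra; letI := f.appTop.hom.toAlgebra;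
      Module.rank (T.residueField y) (T.residueField y ⊗[Γ(T, ⊤)] Γ(Z, ⊤))) := by
  have h1 : IsPullback (f.fiberι y) (f.fiberToSpecResidueField y) f (T.fromSpecResidueField y) :=
    IsPullback.of_hasPullback _ _
  have h2 := (isPushout_appTop_of_isPullback h1.flip).of_iso
    (Iso.refl _) (Scheme.ΓSpecIso _) (Iso.refl _) (Iso.refl _)
    (f' := evalAt T y) (g' := f.appTop)
    (inl' := (Scheme.ΓSpecIso (T.residueField y)).inv ≫ (f.fiberToSpecResidueField y).appTop)
    (inr' := (f.fiberι y).appTop)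
    (by simp) (by simp) (by simp) (by simp)
  exact rank_of_isPushout_tensorProduct h2

/-- The fibre condition at the points of an affine scheme, in terms of the maximal ideals of its
ring of global functions. -/
theorem IsFamily.finrank_eq {Z T : Scheme.{u}} [IsAffine Z] [IsAffine T] {f : Z ⟶ T} {n : ℕ}
    (hf : IsFamily n f) (m : Ideal Γ(T, ⊤)) [m.IsMaximal] :
    (letI := f.appTop.hom.toAlgebra;
      Module.finrank (Γ(T, ⊤) ⧸ m) ((Γ(T, ⊤) ⧸ m) ⊗[Γ(T, ⊤)] Γ(Z, ⊤))) = n := by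
  let := f.appTop.hom.toAlgebra
  let := Ideal.Quotient.field m
  let g : Spec (.of (Γ(T, ⊤) ⧸ m)) ⟶ T :=
    Spec.map (CommRingCat.ofHom (Ideal.Quotient.mk m)) ≫ T.isoSpec.inv
  let y : T := g (IsLocalRing.closedPoint (Γ(T, ⊤) ⧸ m))
  let d := T.descResidueField (Scheme.stalkClosedPointTo g)
  -- the residue field of `T` at the point `y` of `m` maps to `Γ(T, ⊤) ⧸ m`
  have hd : Spec.map d ≫ T.fromSpecResidueField y = g :=
    Scheme.descResidueField_stalkClosedPointTo_fromSpecResidueField _ T g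
  have hc : evalAt T y ≫ d = CommRingCat.ofHom (Ideal.Quotient.mk m) := by
    have h1 : T.isoSpec.inv.appTop ≫ (Scheme.ΓSpecIso Γ(T, ⊤)).hom = 𝟙 _ := by
      rw [← Scheme.toSpecΓ_appTop, ← Scheme.isoSpec_hom, ← Scheme.Hom.comp_appTop]
      simp
    rw [Category.assoc, ← Scheme.ΓSpecIso_naturality, ← Scheme.Hom.comp_appTop_assoc, hd,
      Scheme.Hom.comp_appTop, Category.assoc, Scheme.ΓSpecIso_naturality]
    exact ((Category.assoc _ _ _).symm.trans (congrArg (· ≫ _) h1)).trans (Category.id_comp _)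
  let := (evalAt T y).hom.toAlgebra
  let := d.hom.toAlgebra
  have : IsScalarTower Γ(T, ⊤) (T.residueField y) (Γ(T, ⊤) ⧸ m) :=
    .of_algebraMap_eq' congr(($hc).hom).symm
  rw [finrank_tensorProduct_trans Γ(T, ⊤) (T.residueField y) (Γ(T, ⊤) ⧸ m) Γ(Z, ⊤)]
  have h2 := hf.fiberDim_eq y
  rw [fiberDim_of_isAffine] at h2
  exact Module.finrank_eq_of_rank_eq h2

/-- A pushout of `A` and `k[x]/(x^N)` over `k` is `A[X] ⧸ (X ^ N)`, through evaluation at `x`. -/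
theorem eval₂RingHom_of_isPushout {k : Type u} [Field k] (N : ℕ) {A B : CommRingCat.{u}}
    {a : CommRingCat.of k ⟶ A} {i : A ⟶ B} {j : CommRingCat.of (TruncLine k N) ⟶ B}
    (h : IsPushout a (CommRingCat.ofHom (algebraMap k (TruncLine k N))) i j) :
    Function.Surjective (eval₂RingHom i.hom (j.hom (Ideal.Quotient.mk _ X))) ∧
      RingHom.ker (eval₂RingHom i.hom (j.hom (Ideal.Quotient.mk _ X))) = Ideal.span {X ^ N} := by
  set ε := eval₂RingHom i.hom (j.hom (Ideal.Quotient.mk _ X)) with hε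
  let J : Ideal A[X] := Ideal.span {X ^ N}
  have hX : ε (X ^ N) = 0 := by
    rw [hε, coe_eval₂RingHom, eval₂_X_pow, ← map_pow, ← map_pow,
      Ideal.Quotient.eq_zero_iff_mem.mpr (Ideal.mem_span_singleton_self _), map_zero]
  let s : TruncLine k N →+* A[X] ⧸ J := Ideal.Quotient.lift _
    ((Ideal.Quotient.mk J).comp (mapRingHom a.hom)) (by
      intro f hf
      obtain ⟨g, rfl⟩ := Ideal.mem_span_singleton.mp hf
      rw [map_mul, RingHom.comp_apply, map_pow, coe_mapRingHom, map_X,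
        Ideal.Quotient.eq_zero_iff_mem.mpr (Ideal.mem_span_singleton_self _), zero_mul])
  -- the pushout property gives a map `e` back, and `e` and the map `L` induced by `ε` are inverse
  let e : B ⟶ CommRingCat.of (A[X] ⧸ J) := h.desc
    (CommRingCat.ofHom ((Ideal.Quotient.mk J).comp C)) (CommRingCat.ofHom s) (by
      ext r
      change Ideal.Quotient.mk J (C (a.hom r)) = Ideal.Quotient.mk J ((C r : k[X]).map a.hom)
      rw [map_C])
  have hi (x : A) : e.hom (i.hom x) = Ideal.Quotient.mk J (C x) :=
    congrArg (fun φ : _ ⟶ CommRingCat.of (A[X] ⧸ J) ↦ φ.hom x) (h.inl_desc _ _ _)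
  have hj (x : TruncLine k N) : e.hom (j.hom x) = s x :=
    congrArg (fun φ : _ ⟶ CommRingCat.of (A[X] ⧸ J) ↦ φ.hom x) (h.inr_desc _ _ _)
  have h1 : e.hom.comp ε = Ideal.Quotient.mk J := by
    refine Polynomial.ringHom_ext (fun x ↦ ?_) ?_
    · simp [hε, hi]
    · simp [hε, hj, s]
  let L : (A[X] ⧸ J) →+* B := Ideal.Quotient.lift J ε (by
    intro f hf
    obtain ⟨g, rfl⟩ := Ideal.mem_span_singleton.mp hf
    rw [map_mul, hX, zero_mul])
  have h2 : e ≫ CommRingCat.ofHom L = 𝟙 B := by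
    refine h.hom_ext ?_ ?_
    · ext x
      change L (e.hom (i.hom x)) = i.hom x
      simp [hi, L, hε]
    · refine CommRingCat.hom_ext
        (Ideal.Quotient.ringHom_ext (Polynomial.ringHom_ext (fun r ↦ ?_) ?_))
      · change L (e.hom (j.hom _)) = j.hom _
        have h3 : j.hom (Ideal.Quotient.mk _ (C r)) = i.hom (a.hom r) :=
          congrArg (fun φ : CommRingCat.of k ⟶ B ↦ φ.hom r) h.w.symm
        rw [h3, hi]
        simp [L, hε]
      · change L (e.hom (j.hom _)) = j.hom _
        rw [hj]
        simp [s, L, hε]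
  refine ⟨fun b ↦ ?_, le_antisymm (fun f hf ↦ ?_) ?_⟩
  · obtain ⟨f, hf⟩ := Ideal.Quotient.mk_surjective (e.hom b)
    refine ⟨f, ?_⟩
    have h3 := congr(($h2).hom b)
    change L (e.hom b) = b at h3
    rwa [← hf] at h3
  · have h3 := congr($h1 f)
    rw [RingHom.comp_apply, show ε f = 0 from hf, map_zero] at h3
    exact Ideal.Quotient.eq_zero_iff_mem.mp h3.symm
  · rwa [Ideal.span_singleton_le_iff_mem]

/-! ### Families over an affine base as monic factors of a power of `X` -/

section

variable {k : Type u} [Field k]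

instance (R : Type u) [CommRing R] [Algebra k R] (T : Over (Spec (CommRingCat.of k)))
    [IsAffine T.left] : IsAffine (prodSpec R T) :=
  isAffine_of_isAffineHom (proj R T)

variable (N : ℕ) (T : Over (Spec (CommRingCat.of k)))

/-- The coordinate function `x` on `T ×_k Spec k[x]/(x^N)`. -/
noncomputable def coord : Γ(prodSpec (TruncLine k N) T, ⊤) :=
  ((Scheme.ΓSpecIso (CommRingCat.of (TruncLine k N))).inv ≫
    (projSpec (TruncLine k N) T).appTop).hom (Ideal.Quotient.mk _ X)

/-- A polynomial over the global functions of `T`, as a function on `T ×_k Spec k[x]/(x^N)`. -/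
noncomputable def evalPoly : Γ(T.left, ⊤)[X] →+* Γ(prodSpec (TruncLine k N) T, ⊤) :=
  eval₂RingHom (proj (TruncLine k N) T).appTop.hom (coord N T)

/-- For an affine `T = Spec A`, the ring of functions of `T ×_k Spec k[x]/(x^N)` is
`A[X] ⧸ (X ^ N)`. -/
theorem evalPoly_surjective_and_ker [IsAffine T.left] : Function.Surjective (evalPoly N T) ∧
    RingHom.ker (evalPoly N T) = Ideal.span {X ^ N} := by
  have : IsAffine ((Functor.fromPUnit (Spec (CommRingCat.of k))).obj T.right) :=
    inferInstanceAs (IsAffine (Spec (CommRingCat.of k)))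
  have h := (isPushout_appTop_of_isPullback (isPullback_prodSpec (TruncLine k N) T)).of_iso
    (Scheme.ΓSpecIso (CommRingCat.of k)) (Iso.refl _) (Scheme.ΓSpecIso _) (Iso.refl _)
    (f' := (Scheme.ΓSpecIso (CommRingCat.of k)).inv ≫ (str T).appTop)
    (g' := CommRingCat.ofHom (algebraMap k (TruncLine k N)))
    (inl' := (proj (TruncLine k N) T).appTop)
    (inr' := (Scheme.ΓSpecIso (CommRingCat.of (TruncLine k N))).inv ≫
      (projSpec (TruncLine k N) T).appTop)
    (by simp) (Scheme.ΓSpecIso_naturality _) (by simp) (by simp)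
  exact eval₂RingHom_of_isPushout N h

theorem appTop_prodSpecMap_evalPoly {U T : Over (Spec (CommRingCat.of k))} (f : U ⟶ T)
    (p : Γ(T.left, ⊤)[X]) : (prodSpecMap (TruncLine k N) f).appTop.hom (evalPoly N T p) =
      evalPoly N U (p.map f.left.appTop.hom) := by
  have h1 := congrArg Scheme.Hom.appTop (prodSpecMap_proj (TruncLine k N) f)
  have h2 := congrArg Scheme.Hom.appTop (prodSpecMap_projSpec (TruncLine k N) f)
  rw [Scheme.Hom.comp_appTop] at h1 h2
  rw [Scheme.Hom.comp_appTop] at h1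
  rw [evalPoly, evalPoly, coe_eval₂RingHom, coe_eval₂RingHom, hom_eval₂, eval₂_map]
  congr 1
  · exact congrArg CommRingCat.Hom.hom h1
  · rw [coord, coord, ← h2]
    rfl

/-- The closed subscheme of `T ×_k Spec k[x]/(x^N)` cut out by a polynomial over the global
functions of `T`. The definition is meant for affine `T`, where closed subschemes correspond to
ideals of global functions. -/
noncomputable def cut (p : Γ(T.left, ⊤)[X]) : (prodSpec (TruncLine k N) T).IdealSheafData :=
  .ofIdealTop (Ideal.span {evalPoly N T p})

variable {N T}

theorem comap_cut {U T : Over (Spec (CommRingCat.of k))} [IsAffine U.left] [IsAffine T.left]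
    (f : U ⟶ T) (p : Γ(T.left, ⊤)[X]) : (cut N T p).comap (prodSpecMap (TruncLine k N) f) =
      cut N U (p.map f.left.appTop.hom) := by
  rw [cut, comap_ofIdealTop, Ideal.map_span, Set.image_singleton, appTop_prodSpecMap_evalPoly, cut]

variable [IsAffine T.left]

theorem comap_evalPoly_span {q : Γ(T.left, ⊤)[X]} (hq : q ∣ X ^ N) :
    (Ideal.span {evalPoly N T q}).comap (evalPoly N T) = Ideal.span {q} := by
  obtain ⟨hs, hk⟩ := evalPoly_surjective_and_ker N T
  have h := Ideal.map_span (evalPoly N T) {q}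
  rw [Set.image_singleton] at h
  rw [← h, Ideal.comap_map_of_surjective _ hs,
    ← RingHom.ker_eq_comap_bot, hk, sup_eq_left, Ideal.span_singleton_le_span_singleton]
  exact hq

theorem ideal_cut (p : Γ(T.left, ⊤)[X]) :
    (cut N T p).ideal ⟨⊤, isAffineOpen_top _⟩ = Ideal.span {evalPoly N T p} := by
  simp [cut]

theorem cut_injective {n : ℕ} {p q : MonicDegreeEq Γ(T.left, ⊤) n} (hp : p.1 ∣ X ^ N)
    (hq : q.1 ∣ X ^ N) (h : cut N T p.1 = cut N T q.1) : p = q := by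
  refine MonicDegreeEq.ext_of_span_eq ?_
  rw [← comap_evalPoly_span hp, ← comap_evalPoly_span hq, ← ideal_cut, ← ideal_cut, h]

section

variable {n : ℕ} (Z : (prodSpec (TruncLine k N) T).IdealSheafData)

omit [IsAffine T.left] in
/-- The functions on `Z` form an algebra over the functions on `T`, and evaluating a polynomial at
the coordinate of `Z` restricts its evaluation on the ambient product. -/
theorem aeval_subschemeι (p : Γ(T.left, ⊤)[X]) :
    (letI := (Z.subschemeι ≫ proj _ T).appTop.hom.toAlgebra;
      aeval (R := Γ(T.left, ⊤)) (A := Γ(Z.subscheme, ⊤)) (Z.subschemeι.appTop.hom (coord N T)) p) =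
      Z.subschemeι.appTop.hom (evalPoly N T p) := by
  rw [evalPoly, coe_eval₂RingHom, hom_eval₂]
  rfl

theorem aeval_subschemeι_surjective :
    letI := (Z.subschemeι ≫ proj _ T).appTop.hom.toAlgebra
    Function.Surjective (aeval (R := Γ(T.left, ⊤)) (A := Γ(Z.subscheme, ⊤))
      (Z.subschemeι.appTop.hom (coord N T))) := by
  intro y
  obtain ⟨b, rfl⟩ := Z.subschemeι_app_surjective ⟨⊤, isAffineOpen_top _⟩ y
  obtain ⟨p, rfl⟩ := (evalPoly_surjective_and_ker N T).1 b
  exact ⟨p, aeval_subschemeι Z p⟩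

theorem ker_aeval_subschemeι :
    (letI := (Z.subschemeι ≫ proj _ T).appTop.hom.toAlgebra;
    RingHom.ker (aeval (R := Γ(T.left, ⊤)) (A := Γ(Z.subscheme, ⊤))
      (Z.subschemeι.appTop.hom (coord N T)))) =
      (Z.ideal ⟨⊤, isAffineOpen_top _⟩).comap (evalPoly N T) := by
  ext p
  rw [← Z.ker_subschemeι_app, Ideal.mem_comap, RingHom.mem_ker, RingHom.mem_ker, aeval_subschemeι]
  rfl

/-- Every family over an affine base is cut out by a monic polynomial of degree `n` which divides
`X ^ N`. Together with `cut_injective` and `isFamily_cut`, this identifies the families with the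
monic factors of degree `n` of `X ^ N`. -/
theorem exists_eq_cut (hZ : IsFamily n (Z.subschemeι ≫ proj _ T)) :
    ∃ q : MonicDegreeEq Γ(T.left, ⊤) n, q.1 ∣ X ^ N ∧ Z = cut N T q.1 := by
  have : IsAffine Z.subscheme := isAffine_of_isAffineHom Z.subschemeι
  have := hZ.flat
  have hfl := (Z.subschemeι ≫ proj _ T).flat_appTop
  have hfr := hZ.finrank_eq
  have hs := aeval_subschemeι_surjective Z
  have hk := ker_aeval_subschemeι Z
  have hN := aeval_subschemeι Z (X ^ N)
  obtain ⟨hs', hk'⟩ := evalPoly_surjective_and_ker N T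
  rw [(hk'.ge (Ideal.mem_span_singleton_self _) : evalPoly N T (X ^ N) = 0), map_zero] at hN
  let := (Z.subschemeι ≫ proj _ T).appTop.hom.toAlgebra
  have : Module.Flat Γ(T.left, ⊤) Γ(Z.subscheme, ⊤) := hfl
  rw [map_pow, aeval_X] at hN
  obtain ⟨q, hq⟩ := exists_ker_aeval_eq_span hs ⟨N, hN⟩ (fun m hm ↦ hfr m)
  have hqN : q.1 ∣ X ^ N := by
    rw [← Ideal.mem_span_singleton, ← hq, RingHom.mem_ker, map_pow, aeval_X, hN]
  refine ⟨q, hqN, Scheme.IdealSheafData.ext_of_isAffine ?_⟩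
  refine Ideal.comap_injective_of_surjective _ hs' ?_
  rw [ideal_cut, comap_evalPoly_span hqN, ← hq]
  exact hk.symm

/-- A closed subscheme whose ring of functions is `A[X] ⧸ (q)` is a family, since this ring is free
with basis the powers of `X` below `n`. -/
theorem isFamily_of_comap_evalPoly {q : MonicDegreeEq Γ(T.left, ⊤) n}
    (hq : (Z.ideal ⟨⊤, isAffineOpen_top _⟩).comap (evalPoly N T) = Ideal.span {q.1}) :
    IsFamily n (Z.subschemeι ≫ proj _ T) := by
  have : IsAffine Z.subscheme := isAffine_of_isAffineHom Z.subschemeι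
  have hs := aeval_subschemeι_surjective Z
  have hk := ker_aeval_subschemeι Z
  rw [hq] at hk
  refine ⟨?_, fun y ↦ ?_⟩
  · rw [HasRingHomProperty.iff_of_isAffine (P := @Flat)]
    let := (Z.subschemeι ≫ proj _ T).appTop.hom.toAlgebra
    have := free_of_ker_aeval_eq_span q hs hk
    exact inferInstanceAs (Module.Flat Γ(T.left, ⊤) Γ(Z.subscheme, ⊤))
  · rw [fiberDim_of_isAffine]
    let := (Z.subschemeι ≫ proj _ T).appTop.hom.toAlgebra
    let := (evalAt T.left y).hom.toAlgebra
    exact rank_tensorProduct_of_ker_aeval_eq_span q hs hk (T.left.residueField y)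

theorem isFamily_cut {q : MonicDegreeEq Γ(T.left, ⊤) n} (hq : q.1 ∣ X ^ N) :
    IsFamily n ((cut N T q.1).subschemeι ≫ proj _ T) :=
  isFamily_of_comap_evalPoly _ (by rw [ideal_cut, comap_evalPoly_span hq])

end

end

/-! ### Zariski descent -/

theorem idealSheafData_ext_of_openCover {X : Scheme.{u}} {ι : Type*} {V : ι → Scheme.{u}}
    (f : ∀ i, V i ⟶ X) [∀ i, IsOpenImmersion (f i)] (hf : ∀ x, ∃ i, x ∈ Set.range (f i))
    {I J : X.IdealSheafData} (h : ∀ i, I.comap (f i) = J.comap (f i)) : I = J := by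
  refine Scheme.IdealSheafData.ext_of_iSup_eq_top
    (fun p : Σ i, (V i).affineOpens ↦ ⟨f p.1 ''ᵁ p.2.1, p.2.2.image_of_isOpenImmersion (f p.1)⟩)
    ?_ ?_
  · refine eq_top_iff.mpr fun x _ ↦ ?_
    obtain ⟨i, y, rfl⟩ := hf x
    have hy : y ∈ (⨆ W : (V i).affineOpens, (W : (V i).Opens)) := by
      rw [iSup_affineOpens_eq_top]
      trivial
    obtain ⟨W, hW⟩ := TopologicalSpace.Opens.mem_iSup.mp hy
    exact TopologicalSpace.Opens.mem_iSup.mpr ⟨⟨i, W⟩, y, hW, rfl⟩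
  · rintro ⟨i, W⟩
    have h1 := congr(($(h i)).ideal W)
    rw [Scheme.IdealSheafData.ideal_comap_of_isOpenImmersion,
      Scheme.IdealSheafData.ideal_comap_of_isOpenImmersion] at h1
    exact Ideal.comap_injective_of_surjective _
      ((ConcreteCategory.bijective_of_isIso ((f i).appIso W).inv).2) h1

/-- The inclusion of a member of an open cover of an `S`-scheme. -/
noncomputable abbrev coverι {S : Scheme.{u}} (T : Over S) (𝒰 : Scheme.OpenCover.{u} T.left)
    (i : 𝒰.I₀) : Over.mk (𝒰.f i ≫ T.hom) ⟶ T :=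
  Over.homMk (𝒰.f i)

/-- For a separated Zariski presheaf `F`, an element which is universal among affine schemes is
universal: local classifying morphisms are unique, so they glue. The full sheaf property of `F` is
not needed, because the glued morphism provides the glued element. -/
theorem bijective_of_isAffine {S : Scheme.{u}} (F : (Over S)ᵒᵖ ⥤ Type u) {Y : Over S}
    (u : F.obj (.op Y))
    (hF : ∀ (T : Over S) (𝒰 : Scheme.OpenCover.{u} T.left) (a b : F.obj (.op T)),
      (∀ i, F.map (coverι T 𝒰 i).op a = F.map (coverι T 𝒰 i).op b) → a = b)
    (h : ∀ (T : Over S), IsAffine T.left →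
      Function.Bijective fun g : T ⟶ Y ↦ F.map g.op u) (T : Over S) :
    Function.Bijective fun g : T ⟶ Y ↦ F.map g.op u := by
  have hcomp {V W X : Over S} (p : V ⟶ W) (q : W ⟶ X) (a : F.obj (.op X)) :
      F.map (p ≫ q).op a = F.map p.op (F.map q.op a) := by simp
  -- uniqueness holds over every `T`, in particular over the overlaps, which need not be affine
  have hinj (T : Over S) : Function.Injective fun g : T ⟶ Y ↦ F.map g.op u := by
    intro g₁ g₂ hg
    dsimp only at hg
    ext1
    refine T.left.affineCover.hom_ext _ _ fun i ↦ ?_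
    have := (h (Over.mk (T.left.affineCover.f i ≫ T.hom))
      (inferInstanceAs (IsAffine (T.left.affineCover.X i)))).1
      (a₁ := coverι T _ i ≫ g₁) (a₂ := coverι T _ i ≫ g₂) (by
        dsimp only
        rw [hcomp, hcomp, hg])
    exact congr(($this).left)
  refine ⟨hinj T, fun a ↦ ?_⟩
  set 𝒰 := T.left.affineCover with h𝒰
  have hex (i : 𝒰.I₀) : ∃ g : Over.mk (𝒰.f i ≫ T.hom) ⟶ Y,
      F.map g.op u = F.map (coverι T 𝒰 i).op a :=
    (h (Over.mk (𝒰.f i ≫ T.hom)) (inferInstanceAs (IsAffine (T.left.affineCover.X i)))).2 _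
  choose g hg using hex
  let G : T.left ⟶ Y.left := 𝒰.glueMorphisms (fun i ↦ (g i).left) (by
    intro i j
    let W : Over S := Over.mk (pullback.fst (𝒰.f i) (𝒰.f j) ≫ 𝒰.f i ≫ T.hom)
    let p : W ⟶ Over.mk (𝒰.f i ≫ T.hom) := Over.homMk (pullback.fst (𝒰.f i) (𝒰.f j))
    let q : W ⟶ Over.mk (𝒰.f j ≫ T.hom) := Over.homMk (pullback.snd (𝒰.f i) (𝒰.f j))
      (by simp [W, pullback.condition_assoc])
    have hpq : p ≫ coverι T 𝒰 i = q ≫ coverι T 𝒰 j := by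
      ext1
      exact pullback.condition
    have := hinj W (a₁ := p ≫ g i) (a₂ := q ≫ g j) (by
      dsimp only
      rw [hcomp, hcomp, hg, hg, ← hcomp, ← hcomp, hpq])
    exact congr(($this).left))
  have hG (i) : 𝒰.f i ≫ G = (g i).left := 𝒰.ι_glueMorphisms _ _ i
  let G' : T ⟶ Y := Over.homMk G (by
    refine 𝒰.hom_ext _ _ fun i ↦ ?_
    rw [reassoc_of% hG i]
    exact Over.w (g i))
  refine ⟨G', hF T 𝒰 _ _ fun i ↦ ?_⟩
  dsimp only
  have h1 : coverι T 𝒰 i ≫ G' = g i := by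
    ext1
    exact hG i
  rw [← hcomp, ← hg, h1]

theorem hilb_ext_of_openCover (k : Type u) [Field k] (R : Type u) [CommRing R] [Algebra k R] (n : ℕ)
    (T : Over (Spec (CommRingCat.of k))) (𝒰 : Scheme.OpenCover.{u} T.left)
    (a b : (hilb k R n).obj (.op T))
    (h : ∀ i, (hilb k R n).map (coverι T 𝒰 i).op a = (hilb k R n).map (coverι T 𝒰 i).op b) :
    a = b := by
  have (i : 𝒰.I₀) : IsOpenImmersion (prodSpecMap R (coverι T 𝒰 i)) :=
    have : IsOpenImmersion (coverι T 𝒰 i).left := inferInstanceAs (IsOpenImmersion (𝒰.f i))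
    MorphismProperty.of_isPullback (isPullback_prodSpecMap R (coverι T 𝒰 i)).flip this
  refine Subtype.ext (idealSheafData_ext_of_openCover (fun i ↦ prodSpecMap R (coverι T 𝒰 i))
    (fun x ↦ ?_) fun i ↦ congr(($(h i)).1))
  obtain ⟨i, t, ht⟩ := 𝒰.exists_eq (proj R T x)
  have h1 := Scheme.image_preimage_eq_of_isPullback
    (isPullback_prodSpecMap R (coverι T 𝒰 i)).flip Set.univ
  rw [Set.preimage_univ, Set.image_univ, Set.image_univ] at h1
  exact ⟨i, h1.ge ⟨t, ht⟩⟩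

/-! ### The representing scheme -/

section

variable (k : Type u) [Field k] (n m : ℕ)

/-- The ring whose spectrum represents `H^{n,m}`: the universal ring over which `x^(n+m)` is the
product of a monic polynomial of degree `n` and a monic polynomial of degree `m`. -/
abbrev FactorRing : Type u :=
  UniversalFactorizationRing n m rfl
    (MonicDegreeEq.mk (X ^ (n + m) : k[X]) (monic_X_pow _) (natDegree_X_pow _))

/-- The scheme `Spec (FactorRing k n m)` over `k`. -/
noncomputable abbrev factorScheme : Over (Spec (CommRingCat.of k)) :=
  Over.mk (specStr k (FactorRing k n m))

instance : IsAffine (factorScheme k n m).left :=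
  inferInstanceAs (IsAffine (Spec (CommRingCat.of (FactorRing k n m))))

/-- The universal monic factor of degree `n` of `X ^ (n + m)`. -/
noncomputable abbrev univPoly₁ : MonicDegreeEq (FactorRing k n m) n :=
  UniversalFactorizationRing.factor₁ n m rfl _

/-- The cofactor of `univPoly₁`, which is monic of degree `m`. -/
noncomputable abbrev univPoly₂ : MonicDegreeEq (FactorRing k n m) m :=
  UniversalFactorizationRing.factor₂ n m rfl _

theorem univPoly₁_mul_univPoly₂ : (univPoly₁ k n m).1 * (univPoly₂ k n m).1 = X ^ (n + m) := by
  rw [UniversalFactorizationRing.factor₁_mul_factor₂]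
  simp

/-- The universal factor `univPoly₁`, with coefficients in the global functions of the scheme. -/
noncomputable abbrev factorScheme.poly : MonicDegreeEq Γ((factorScheme k n m).left, ⊤) n :=
  (univPoly₁ k n m).map (Scheme.ΓSpecIso (CommRingCat.of (FactorRing k n m))).inv.hom

theorem factorScheme.poly_dvd : (factorScheme.poly k n m).1 ∣ X ^ (n + m) := by
  have h := congr(Polynomial.map (Scheme.ΓSpecIso (CommRingCat.of (FactorRing k n m))).inv.hom
    $(univPoly₁_mul_univPoly₂ k n m))
  rw [Polynomial.map_mul, Polynomial.map_pow, map_X] at h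
  exact ⟨_, h.symm⟩

/-- The universal family, cut out by the universal factor. -/
noncomputable def univFamily : (hilbTrunc k n m).obj (.op (factorScheme k n m)) :=
  ⟨cut (n + m) (factorScheme k n m) (factorScheme.poly k n m).1,
    isFamily_cut (factorScheme.poly_dvd k n m)⟩

variable {k n m}

/-- The ring map from `FactorRing k n m` to the global functions of `T` which a morphism to the
spectrum of that ring induces. -/
noncomputable abbrev globalHom {T : Over (Spec (CommRingCat.of k))} (g : T ⟶ factorScheme k n m) :
    CommRingCat.of (FactorRing k n m) ⟶ Γ(T.left, ⊤) :=
  (Scheme.ΓSpecIso (CommRingCat.of (FactorRing k n m))).inv ≫ g.left.appTop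

/-- Over an affine `T`, the family classified by `g` is cut out by the image of the universal factor
under the ring map of `g`. -/
theorem map_univFamily {T : Over (Spec (CommRingCat.of k))} [IsAffine T.left]
    (g : T ⟶ factorScheme k n m) : ((hilbTrunc k n m).map g.op (univFamily k n m)).1 =
      cut (n + m) T ((univPoly₁ k n m).1.map (globalHom g).hom) := by
  refine (comap_cut g _).trans ?_
  congr 1
  exact Polynomial.map_map _ _ _

theorem univPoly₁_map_dvd {A : Type*} [CommRing A] (φ : FactorRing k n m →+* A) :
    (univPoly₁ k n m).1.map φ ∣ X ^ (n + m) := by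
  have h := congr(Polynomial.map φ $(univPoly₁_mul_univPoly₂ k n m))
  rw [Polynomial.map_mul, Polynomial.map_pow, map_X] at h
  exact ⟨_, h.symm⟩

/-- A map out of `FactorRing k n m` is determined by the image of the universal factor, because the
cofactor is the quotient of `X ^ (n + m)` by a monic, hence regular, polynomial. -/
theorem algHom_factorRing_ext {A : Type u} [CommRing A] [Algebra k A]
    {φ ψ : FactorRing k n m →ₐ[k] A}
    (h : (univPoly₁ k n m).1.map φ.toRingHom = (univPoly₁ k n m).1.map ψ.toRingHom) : φ = ψ := by
  refine (UniversalFactorizationRing.homEquiv (S := A) n m rfl _).injective ?_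
  have h2 (χ : FactorRing k n m →ₐ[k] A) : (univPoly₁ k n m).1.map χ.toRingHom *
      (univPoly₂ k n m).1.map χ.toRingHom = X ^ (n + m) := by
    rw [← Polynomial.map_mul, univPoly₁_mul_univPoly₂]
    simp
  refine Subtype.ext (Prod.ext (Subtype.ext h) (Subtype.ext ?_))
  have h3 := (h2 φ).trans (h2 ψ).symm
  rw [h] at h3
  exact ((univPoly₁ k n m).monic.map ψ.toRingHom).isRegular.left h3

theorem globalHom_comp {T : Over (Spec (CommRingCat.of k))} (g : T ⟶ factorScheme k n m) :
    CommRingCat.ofHom (algebraMap k (FactorRing k n m)) ≫ globalHom g =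
      (Scheme.ΓSpecIso (CommRingCat.of k)).inv ≫ T.hom.appTop := by
  have h := congrArg Scheme.Hom.appTop (Over.w g)
  rw [Scheme.Hom.comp_appTop] at h
  rw [← h, Scheme.ΓSpecIso_inv_naturality_assoc]
  rfl

theorem ΓSpecIso_inv_comp_appTop {X : Scheme.{u}} {R : CommRingCat.{u}} (φ : R ⟶ Γ(X, ⊤)) :
    (Scheme.ΓSpecIso R).inv ≫ (X.toSpecΓ ≫ Spec.map φ).appTop = φ := by
  rw [Scheme.Hom.comp_appTop, ← Scheme.ΓSpecIso_inv_naturality_assoc, Scheme.toSpecΓ_appTop,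
    Iso.inv_hom_id, Category.comp_id]

theorem bijective_map_univFamily_of_isAffine (T : Over (Spec (CommRingCat.of k)))
    [IsAffine T.left] : Function.Bijective fun g : T ⟶ factorScheme k n m ↦
      (hilbTrunc k n m).map g.op (univFamily k n m) := by
  let := ((Scheme.ΓSpecIso (CommRingCat.of k)).inv ≫ T.hom.appTop).hom.toAlgebra
  let alg (g : T ⟶ factorScheme k n m) : FactorRing k n m →ₐ[k] Γ(T.left, ⊤) :=
    { (globalHom g).hom with commutes' r := congr(($(globalHom_comp g)).hom r) }
  constructor
  · intro g₁ g₂ hg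
    have h1 := congr(($hg).1)
    dsimp only at h1
    rw [map_univFamily, map_univFamily] at h1
    have h2 := cut_injective (p := (univPoly₁ k n m).map (globalHom g₁).hom)
      (q := (univPoly₁ k n m).map (globalHom g₂).hom) (univPoly₁_map_dvd _) (univPoly₁_map_dvd _) h1
    have h3 : alg g₁ = alg g₂ := algHom_factorRing_ext congr(($h2).1)
    have h4 : globalHom g₁ = globalHom g₂ :=
      CommRingCat.hom_ext (RingHom.ext fun x ↦ congr($h3 x))
    ext1
    exact ext_to_Spec h4
  · intro Z
    obtain ⟨q, hq, hZ⟩ := exists_eq_cut Z.1 Z.2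
    obtain ⟨r, hr⟩ := MonicDegreeEq.exists_mul_eq_X_pow hq
    let e := (UniversalFactorizationRing.homEquiv (R := k) Γ(T.left, ⊤) n m rfl
      (MonicDegreeEq.mk (X ^ (n + m) : k[X]) (monic_X_pow _) (natDegree_X_pow _)))
    let φ : FactorRing k n m →ₐ[k] Γ(T.left, ⊤) := e.symm ⟨(q, r), by simp [hr]⟩
    have hφ : (univPoly₁ k n m).1.map φ.toRingHom = q.1 :=
      congr(($(e.apply_symm_apply ⟨(q, r), by simp [hr]⟩)).1.1.1)
    let g : T ⟶ factorScheme k n m := Over.homMk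
      (T.left.toSpecΓ ≫ Spec.map (CommRingCat.ofHom φ.toRingHom)) (by
        refine ext_to_Spec ?_
        have h1 : CommRingCat.ofHom (algebraMap k (FactorRing k n m)) ≫
          CommRingCat.ofHom φ.toRingHom = (Scheme.ΓSpecIso (CommRingCat.of k)).inv ≫ T.hom.appTop :=
          CommRingCat.hom_ext φ.comp_algebraMap
        refine Eq.trans ?_ h1
        have h2 : (T.left.toSpecΓ ≫ Spec.map (CommRingCat.ofHom φ.toRingHom)) ≫
            specStr k (FactorRing k n m) = T.left.toSpecΓ ≫ Spec.map
              (CommRingCat.ofHom (algebraMap k _) ≫ CommRingCat.ofHom φ.toRingHom) := by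
          rw [Category.assoc, ← Spec.map_comp]
        exact (congrArg (fun f ↦ (Scheme.ΓSpecIso (CommRingCat.of k)).inv ≫ f.appTop) h2).trans
          (ΓSpecIso_inv_comp_appTop _))
    refine ⟨g, Subtype.ext ?_⟩
    have hg : globalHom g = CommRingCat.ofHom φ.toRingHom :=
      ΓSpecIso_inv_comp_appTop _
    dsimp only
    rw [map_univFamily, hZ, hg, ← hφ]
    rfl

theorem bijective_map_univFamily (T : Over (Spec (CommRingCat.of k))) :
    Function.Bijective fun g : T ⟶ factorScheme k n m ↦
      (hilbTrunc k n m).map g.op (univFamily k n m) :=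
  bijective_of_isAffine _ _ (hilb_ext_of_openCover k _ n)
    (fun T _ ↦ bijective_map_univFamily_of_isAffine T) T

variable (k n m) in
/-- The functor `H^{n,m}` is represented by the spectrum of `FactorRing k n m`. -/
noncomputable def hilbTruncRepresentableBy :
    (hilbTrunc k n m).RepresentableBy (factorScheme k n m) where
  homEquiv := Equiv.ofBijective _ (bijective_map_univFamily _)
  homEquiv_comp f g := by simp

end

/-! ### Closed subfunctors -/

/-- Pulling a closed subscheme of `X` back from `Y` recovers it, because `X ×_Y X = X` for a
monomorphism. -/
theorem comap_map_eq_self {X Y : Scheme.{u}} (i : X ⟶ Y) [IsClosedImmersion i]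
    (I : X.IdealSheafData) : (I.map i).comap i = I := by
  rw [← comap_map_of_isPullback (IsKernelPair.id_of_mono i) I]
  simp

theorem hilbPush_app_injective {k : Type u} [Field k] {R S : Type u} [CommRing R] [Algebra k R]
    [CommRing S] [Algebra k S] (φ : R →ₐ[k] S) (hφ : Function.Surjective φ) (n : ℕ)
    (T : (Over (Spec (CommRingCat.of k)))ᵒᵖ) :
    Function.Injective ((hilbPush R φ hφ n).app T) := by
  intro Z₁ Z₂ h
  have := isClosedImmersion_prodSpecChange φ hφ T.unop
  have h1 : Z₁.1.map (prodSpecChange φ T.unop) = Z₂.1.map (prodSpecChange φ T.unop) := congr(($h).1)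
  refine Subtype.ext ?_
  rw [← comap_map_eq_self (prodSpecChange φ T.unop) Z₁.1, h1, comap_map_eq_self]

theorem mono_of_app_injective {C : Type*} [Category* C] {F G : Cᵒᵖ ⥤ Type u} (η : F ⟶ G)
    (h : ∀ T, Function.Injective (η.app T)) : Mono η :=
  have (T : Cᵒᵖ) : Mono (η.app T) := (mono_iff_injective _).mpr (h T)
  NatTrans.mono_of_mono_app η

section

variable {C : Type (u + 1)} [Category.{u} C] {F G : Cᵒᵖ ⥤ Type u} {η : F ⟶ G} {X Y : C}
  {hF : F.RepresentableBy X} {hG : G.RepresentableBy Y} {f : X ⟶ Y}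

/-- If `f` is the morphism of representing objects which corresponds to `η`, composition with `f`
corresponds to `η` on all morphisms, by the Yoneda lemma. -/
theorem homEquiv_comp_of_homEquiv_eq (hf : hG.homEquiv f = η.app (.op X) (hF.homEquiv (𝟙 X)))
    {T : C} (x : T ⟶ X) : hG.homEquiv (x ≫ f) = η.app (.op T) (hF.homEquiv x) := by
  rw [hG.homEquiv_comp, hf, ← NatTrans.naturality_apply, ← hF.homEquiv_comp, Category.comp_id]

theorem mono_of_homEquiv_eq (hf : hG.homEquiv f = η.app (.op X) (hF.homEquiv (𝟙 X)))
    (hη : ∀ T, Function.Injective (η.app T)) : Mono f where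
  right_cancellation x y h := hF.homEquiv.injective (hη _ (by
    rw [← homEquiv_comp_of_homEquiv_eq hf, h, homEquiv_comp_of_homEquiv_eq hf]))

/-- A transformation of representable functors is relatively representable with property `P` as soon
as the morphism of representing objects has pullbacks whose projections satisfy `P`. -/
theorem presheaf_of_homEquiv_eq (hf : hG.homEquiv f = η.app (.op X) (hF.homEquiv (𝟙 X)))
    {P : MorphismProperty C} [P.RespectsIso] (h : ∀ {a : C} (g : a ⟶ Y),
      ∃ (b : C) (fst : b ⟶ X) (snd : b ⟶ a), IsPullback fst snd f g ∧ P snd) : P.presheaf η := by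
  have hf' : yoneda.map f ≫ hG.toIso.hom = hF.toIso.hom ≫ η := by
    ext T x
    exact homEquiv_comp_of_homEquiv_eq hf x
  refine MorphismProperty.relative.of_exists fun a g ↦ ?_
  let g' : a ⟶ Y := yoneda.preimage (g ≫ hG.toIso.inv)
  have hg : yoneda.map g' = g ≫ hG.toIso.inv := yoneda.map_preimage _
  obtain ⟨b, fst, snd, hp, hs⟩ := h g'
  refine ⟨b, yoneda.map fst ≫ hF.toIso.hom, snd, ?_, hs⟩
  exact (hp.map yoneda).of_iso (Iso.refl _) hF.toIso (Iso.refl _) hG.toIso (by simp) (by simp)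
    hf' (by simp [hg])

end

section

variable (k : Type u) [Field k]

theorem exists_isPullback_closedImm {X Y : Over (Spec (CommRingCat.of k))} (f : X ⟶ Y)
    (hf : IsClosedImmersion f.left) {a : Over (Spec (CommRingCat.of k))} (g : a ⟶ Y) :
    ∃ (b : _) (fst : b ⟶ X) (snd : b ⟶ a), IsPullback fst snd f g ∧ closedImm k snd := by
  have h := IsPullback.of_hasPullback f g
  exact ⟨_, _, _, h,
    MorphismProperty.of_isPullback (P := @IsClosedImmersion) (h.map (Over.forget _)) hf⟩

theorem isNoetherian_of_isClosedImmersion {X Y : Scheme.{u}} (f : X ⟶ Y) [IsClosedImmersion f]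
    [IsNoetherian Y] : IsNoetherian X where
  toIsLocallyNoetherian := LocallyOfFiniteType.isLocallyNoetherian f
  toCompactSpace := QuasiCompact.compactSpace_of_compactSpace f

/-- The pullback of a closed immersion along a morphism from a noetherian scheme is noetherian, so
that it is a pullback in the category of noetherian schemes too. -/
theorem exists_isPullback_closedImmNoeth {X Y : (isNoeth k).FullSubcategory} (f : X ⟶ Y)
    (hf : IsClosedImmersion f.hom.left) {a : (isNoeth k).FullSubcategory} (g : a ⟶ Y) :
    ∃ (b : _) (fst : b ⟶ X) (snd : b ⟶ a), IsPullback fst snd f g ∧ closedImmNoeth k snd := by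
  obtain ⟨b, fst, snd, hp, hs⟩ := exists_isPullback_closedImm k f.hom hf g.hom
  have : IsNoetherian a.obj.left := a.property
  have : IsClosedImmersion snd.left := hs
  let b' : (isNoeth k).FullSubcategory := ⟨b, isNoetherian_of_isClosedImmersion snd.left⟩
  let fst' : b' ⟶ X := ObjectProperty.homMk fst
  let snd' : b' ⟶ a := ObjectProperty.homMk snd
  refine ⟨b', fst', snd', ?_, hs⟩
  exact IsPullback.of_map (isNoeth k).ι (ObjectProperty.hom_ext _ hp.w) hp

instance : (closedImm k).RespectsIso :=
  MorphismProperty.RespectsIso.inverseImage (@IsClosedImmersion : MorphismProperty Scheme.{u})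
    (Over.forget (Spec (CommRingCat.of k)))

instance : (closedImmNoeth k).RespectsIso :=
  inferInstanceAs (MorphismProperty.RespectsIso ((closedImm k).inverseImage _))

variable (n m : ℕ)

instance : IsFinite (factorScheme k n m).hom := by
  refine (IsFinite.SpecMap_iff _).mpr ?_
  exact RingHom.finite_algebraMap.mpr inferInstance

instance : IsNoetherian (factorScheme k n m).left :=
  have : IsNoetherianRing (FactorRing k n m) := IsNoetherianRing.of_finite k _
  inferInstanceAs (IsNoetherian (Spec (CommRingCat.of (FactorRing k n m))))

/-- A monomorphism between the representing schemes is a closed immersion, because these schemes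
are finite over `k`. -/
theorem isClosedImmersion_of_mono {n m n' m' : ℕ} (f : factorScheme k n m ⟶ factorScheme k n' m')
    [Mono f] : IsClosedImmersion f.left := by
  rw [IsClosedImmersion.iff_isFinite_and_mono]
  refine ⟨?_, inferInstance⟩
  have : IsFinite (f.left ≫ (factorScheme k n' m').hom) := by
    rw [Over.w f]
    infer_instance
  exact IsFinite.of_comp f.left (factorScheme k n' m').hom

/-- The representing scheme as a noetherian `k`-scheme. -/
noncomputable abbrev factorSchemeNoeth : (isNoeth k).FullSubcategory :=
  ⟨factorScheme k n m, inferInstance⟩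

/-- The representing scheme of `H^{n,m}` is noetherian, so it represents the restriction of
`H^{n,m}` to noetherian schemes. -/
noncomputable def hilbTruncNoethRepresentableBy :
    (hilbTruncNoeth k n m).RepresentableBy (factorSchemeNoeth k n m) where
  homEquiv := (isNoeth k).fullyFaithfulι.homEquiv.trans (hilbTruncRepresentableBy k n m).homEquiv
  homEquiv_comp f g := (hilbTruncRepresentableBy k n m).homEquiv_comp f.hom g.hom

/-- The morphism of representing schemes which corresponds to the inclusion of `H^{n,m}` in
`H^{n,m+1}`. -/
noncomputable def factorSchemeIncl : factorScheme k n m ⟶ factorScheme k n (m + 1) :=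
  (hilbTruncRepresentableBy k n (m + 1)).homEquiv.symm
    ((truncIncl k n m).app _ ((hilbTruncRepresentableBy k n m).homEquiv (𝟙 _)))

theorem homEquiv_factorSchemeIncl :
    (hilbTruncRepresentableBy k n (m + 1)).homEquiv (factorSchemeIncl k n m) =
      (truncIncl k n m).app _ ((hilbTruncRepresentableBy k n m).homEquiv (𝟙 _)) :=
  Equiv.apply_symm_apply _ _

instance : IsClosedImmersion (factorSchemeIncl k n m).left :=
  have := mono_of_homEquiv_eq (homEquiv_factorSchemeIncl k n m) (hilbPush_app_injective _ _ n)
  isClosedImmersion_of_mono k _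

theorem presheaf_truncIncl : (closedImm k).presheaf (truncIncl k n m) :=
  presheaf_of_homEquiv_eq (homEquiv_factorSchemeIncl k n m)
    (exists_isPullback_closedImm k _ inferInstance)

theorem presheaf_truncInclNoeth : (closedImmNoeth k).presheaf (truncInclNoeth k n m) :=
  presheaf_of_homEquiv_eq (η := truncInclNoeth k n m) (hF := hilbTruncNoethRepresentableBy k n m)
    (hG := hilbTruncNoethRepresentableBy k n (m + 1))
    (f := ObjectProperty.homMk (factorSchemeIncl k n m)) (homEquiv_factorSchemeIncl k n m)
    (exists_isPullback_closedImmNoeth k _ (inferInstanceAs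
      (IsClosedImmersion (factorSchemeIncl k n m).left)))

end

/-! ### The union -/

section

variable {k : Type u} [Field k]

theorem prodSpecChange_comp {R S S' : Type u} [CommRing R] [Algebra k R] [CommRing S] [Algebra k S]
    [CommRing S'] [Algebra k S'] (φ : R →ₐ[k] S) (ψ : S →ₐ[k] S')
    (T : Over (Spec (CommRingCat.of k))) :
    prodSpecChange (ψ.comp φ) T = prodSpecChange ψ T ≫ prodSpecChange φ T := by
  refine (isPullback_prodSpec R T).hom_ext ?_ ?_
  · simp
  · rw [Category.assoc, prodSpecChange_projSpec, prodSpecChange_projSpec, ← Category.assoc,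
      prodSpecChange_projSpec, Category.assoc, ← Spec.map_comp]
    rfl

theorem truncToTrunc_comp_localToTrunc (N : ℕ) :
    (truncToTrunc k N).comp (localToTrunc k (N + 1)) = localToTrunc k N := by
  refine AlgHom.coe_ringHom_injective (IsLocalization.ringHom_ext (originIdeal k).primeCompl ?_)
  refine RingHom.ext fun f ↦ ?_
  change truncToTrunc k N (localToTrunc k (N + 1) (algebraMap k[X] (LocalLine k) f)) =
    localToTrunc k N (algebraMap k[X] (LocalLine k) f)
  rw [localToTrunc_algebraMap, localToTrunc_algebraMap]
  rfl

/-- A ring map out of `k[x]_(x)` which kills `x ^ N` kills the kernel of `k[x]_(x) → k[x]/(x^N)`. -/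
theorem map_eq_zero_of_localToTrunc_eq_zero {N : ℕ} {a : LocalLine k}
    (ha : localToTrunc k N a = 0) {B : Type*} [CommRing B] (ψ : LocalLine k →+* B)
    (hψ : ψ (algebraMap k[X] _ X) ^ N = 0) : ψ a = 0 := by
  obtain ⟨⟨f, g⟩, h⟩ := IsLocalization.surj (originIdeal k).primeCompl a
  have h1 := congr(localToTrunc k N $h)
  rw [map_mul, ha, zero_mul, localToTrunc_algebraMap] at h1
  obtain ⟨q, hq⟩ := Ideal.mem_span_singleton.mp (Ideal.Quotient.eq_zero_iff_mem.mp h1.symm)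
  have h2 := congr(ψ $h)
  dsimp only at h2 hq
  rw [map_mul, hq, map_mul, map_pow, map_mul, map_pow, hψ, zero_mul] at h2
  exact ((IsLocalization.map_units (LocalLine k) g).map ψ).mul_left_eq_zero.mp h2

theorem toSpecΓ_comp_map_comp_map {X : Scheme.{u}} {R S : CommRingCat.{u}} {j : X ⟶ Spec R}
    {φ : R ⟶ S} {ψ : S ⟶ Γ(X, ⊤)} (h : φ ≫ ψ = (Scheme.ΓSpecIso R).inv ≫ j.appTop) :
    (X.toSpecΓ ≫ Spec.map ψ) ≫ Spec.map φ = j := by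
  rw [Category.assoc, ← Spec.map_comp]
  exact ext_to_Spec ((ΓSpecIso_inv_comp_appTop _).trans h)

/-- A closed subscheme `Z` supported at the origin comes from `T ×_k Spec k[x]/(x^N)` for all large
`N`: the function `x` vanishes at every point of `Z`, and a function on a quasi-compact scheme which
vanishes at every point is nilpotent. -/
theorem exists_map_prodSpecChange_eq {n : ℕ} {T : Over (Spec (CommRingCat.of k))}
    [CompactSpace T.left] {z : (hilb k (LocalLine k) n).obj (.op T)}
    (hz : z ∈ (hilbSupp k (LocalLine k) n).obj (.op T)) :
    ∃ N₀, ∀ N ≥ N₀, ∃ Z' : (prodSpec (TruncLine k N) T).IdealSheafData,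
      Z'.map (prodSpecChange (localToTrunc k N) T) = z.1 := by
  have hZ' := (ker_le_radical_iff _ (Ideal.Quotient.mkₐ_surjective _ _) _ _).mp hz
  set Z : (prodSpec (LocalLine k) T).IdealSheafData := z.1
  have hk : RingHom.ker (Ideal.Quotient.mkₐ k (IsLocalRing.maximalIdeal (LocalLine k))) =
    IsLocalRing.maximalIdeal (LocalLine k) := Ideal.mk_ker
  rw [hk] at hZ'
  have : CompactSpace Z.subscheme :=
    QuasiCompact.compactSpace_of_compactSpace (Z.subschemeι ≫ proj (LocalLine k) T)
  let j := Z.subschemeι ≫ projSpec (LocalLine k) T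
  let ψ : LocalLine k →+* Γ(Z.subscheme, ⊤) :=
    ((Scheme.ΓSpecIso (CommRingCat.of (LocalLine k))).inv ≫ j.appTop).hom
  let x : LocalLine k := algebraMap k[X] _ X
  have hx : x ∈ IsLocalRing.maximalIdeal (LocalLine k) := by
    rw [← Localization.AtPrime.map_eq_maximalIdeal]
    exact Ideal.mem_map_of_mem _ (Ideal.mem_span_singleton_self _)
  obtain ⟨N₀, hN₀⟩ : IsNilpotent (ψ x) := by
    -- the locus where `x` does not vanish is empty
    rw [Scheme.isNilpotent_iff_basicOpen_eq_bot]
    refine eq_bot_iff.mpr fun w hw ↦ ?_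
    have h1 : Z.subscheme.basicOpen (ψ x) =
        j ⁻¹ᵁ (Spec _).basicOpen ((Scheme.ΓSpecIso (CommRingCat.of (LocalLine k))).inv.hom x) :=
      (Scheme.preimage_basicOpen_top j _).symm
    rw [h1, basicOpen_eq_of_affine] at hw
    exact hw (hZ' (Z.subschemeι w) (by
      rw [← SetLike.mem_coe, ← Z.range_subschemeι]; exact ⟨w, rfl⟩) hx)
  refine ⟨N₀, fun N hN ↦ ?_⟩
  let ψ' : TruncLine k N →+* Γ(Z.subscheme, ⊤) :=
    RingHom.liftOfSurjective (localToTrunc k N).toRingHom (localToTrunc_surjective k N)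
      ⟨ψ, fun a ha ↦ map_eq_zero_of_localToTrunc_eq_zero ha ψ (pow_eq_zero_of_le hN hN₀)⟩
  have hψ : ψ'.comp (localToTrunc k N).toRingHom = ψ :=
    RingHom.liftOfRightInverse_comp _ _ _ _
  have hw : Z.subschemeι ≫ projSpec (LocalLine k) T =
      (Z.subscheme.toSpecΓ ≫ Spec.map (CommRingCat.ofHom ψ')) ≫ specMap (localToTrunc k N) :=
    (toSpecΓ_comp_map_comp_map (CommRingCat.hom_ext hψ)).symm
  let l := (isPullback_prodSpecChange (localToTrunc k N) T).lift Z.subschemeι _ hw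
  refine ⟨l.ker, ?_⟩
  rw [Scheme.IdealSheafData.map_ker, (isPullback_prodSpecChange (localToTrunc k N) T).lift_fst,
    Scheme.IdealSheafData.ker_subschemeι]

/-- Being a family does not depend on the ambient scheme. -/
theorem isFamily_of_map {n : ℕ} {X Y T : Scheme.{u}} (i : X ⟶ Y) [IsClosedImmersion i]
    (I : X.IdealSheafData) (p : X ⟶ T) (q : Y ⟶ T) (h : i ≫ q = p) [IsAffineHom q]
    (hI : IsFamily n ((I.map i).subschemeι ≫ q)) : IsFamily n (I.subschemeι ≫ p) := by
  have h1 := isPullback_map i I p q h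
  have h2 : IsPullback (inv (inv (I.subschemeι ≫ i).toImage)) (I.subschemeι ≫ p)
      ((I.map i).subschemeι ≫ q) (𝟙 T) := by
    refine IsPullback.of_horiz_isIso ⟨?_⟩
    rw [IsIso.inv_comp_eq, Category.comp_id, h1.w, Category.comp_id]
  exact IsFamily.of_isPullback (f := (I.map i).subschemeι ≫ q) h2 hI

instance (n m : ℕ) : Mono (truncToLocal k n m) :=
  mono_of_app_injective _ fun T _ _ h ↦ hilbPush_app_injective _ (localToTrunc_surjective k (n + m))
    n ((isNoeth k).ι.op.obj T) congr(($h).1)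

theorem truncInclNoeth_comp_truncToLocal (n m : ℕ) :
    truncInclNoeth k n m ≫ truncToLocal k n (m + 1) = truncToLocal k n m := by
  ext T Z
  refine Subtype.ext (Subtype.ext ?_)
  change (Z.1.map (prodSpecChange (truncToTrunc k (n + m)) _)).map
    (prodSpecChange (localToTrunc k (n + m + 1)) _) = Z.1.map (prodSpecChange (localToTrunc k _) _)
  rw [← Scheme.IdealSheafData.map_comp, ← prodSpecChange_comp, truncToTrunc_comp_localToTrunc]

theorem iSup_range_truncToLocal (n : ℕ) : ⨆ m, Subfunctor.range (truncToLocal k n m) = ⊤ := by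
  refine eq_top_iff.mpr fun T z _ ↦ ?_
  have : IsNoetherian T.unop.obj.left := T.unop.property
  obtain ⟨N₀, h⟩ := exists_map_prodSpecChange_eq (T := T.unop.obj) z.2
  -- take `m = N₀`, so that the exponent `n + m` is large enough
  obtain ⟨Z', hZ'⟩ := h (n + N₀) (Nat.le_add_left _ _)
  have := isClosedImmersion_prodSpecChange (localToTrunc k (n + N₀))
    (localToTrunc_surjective k (n + N₀)) T.unop.obj
  have hf : IsFamily n (Z'.subschemeι ≫ proj (TruncLine k (n + N₀)) T.unop.obj) :=
    isFamily_of_map (prodSpecChange (localToTrunc k (n + N₀)) T.unop.obj) Z' _ _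
      (prodSpecChange_proj _ _) (by rw [hZ']; exact z.1.2)
  rw [Subfunctor.iSup_obj, Set.mem_iUnion]
  exact ⟨N₀, ⟨Z', hf⟩, Subtype.ext (Subtype.ext hZ')⟩

end

end PunctualHilb

open PunctualHilb in
theorem theorem6p8 (k : Type u) [Field k] (n : ℕ) (hn : 0 < n) :
    -- on all `k`-schemes
    (∀ m, (hilbTrunc k n m).IsRepresentable) ∧
    (∀ m, (closedImm k).presheaf (truncIncl k n m)) ∧
    -- on noetherian `k`-schemes
    (∀ m, (hilbTruncNoeth k n m).IsRepresentable) ∧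
    (∀ m, (closedImmNoeth k).presheaf (truncInclNoeth k n m)) ∧
    (∀ m, Mono (truncToLocal k n m)) ∧
    (∀ m, truncInclNoeth k n m ≫ truncToLocal k n (m + 1) = truncToLocal k n m) ∧
    ⨆ m, Subfunctor.range (truncToLocal k n m) = ⊤ :=
  ⟨fun m ↦ (hilbTruncRepresentableBy k n m).isRepresentable, presheaf_truncIncl k n,
    fun m ↦ (hilbTruncNoethRepresentableBy k n m).isRepresentable, presheaf_truncInclNoeth k n,
    fun _ ↦ inferInstance, truncInclNoeth_comp_truncToLocal n, iSup_range_truncToLocal n⟩
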